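/- Let $k$ be an algebraically closed field of characteristic $p>0$, $k[\mathbb G_a]=k[T]$, and let $\mathbb G_{a(r)}\subset\mathbb G_a$ ($r>0$) be the $r$-th Frobenius kernel, with $k[\mathbb G_{a(r)}]=k[T]/T^{p^r}$. Let $V(\mathbb G_a)=\mathrm{Hom}_{grp/k}(\mathbb G_a,\mathbb G_a)$; its elements are $\sigma_{\underline a}:T\mapsto\sum_{s\ge0}a_sT^{p^s}$ for finite sequences $\underline a=(a_0,a_1,\dots)$ in $k$. Let $V_r(\mathbb G_a)(k)=\mathrm{Hom}_{grp/k}(\mathbb G_{a(r)},\mathbb G_a)\cong k^r$, with elements $\mu_{\underline b}: T\mapsto\sum_{s<r}b_sT^{p^s}$ and the Zariski topology; let $pr_r:V(\mathbb G_a)\to V_r(\mathbb G_a)(k)$ be restriction, $\sigma_{\underline a}\mapsto\mu_{(a_0,\dots,a_{r-1})}$, give $V(\mathbb G_a)$ the weakest topology making all $pr_r$ continuous, and let $\lambda_{r,r}(\mu_{(b_0,\dots,b_{r-1})})=\mu_{(b_{r-1},\dots,b_0)}$. Let $M$ be a finite dimensional rational $\mathbb G_a$-module with coaction $\Delta_M:M\to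 M\otimes k[T]$; a functional $\phi$ on $k[T]$ acts on $M$ by $(\mathrm{id}\otimes\phi)\circ\Delta_M$. $M$ has degree $<p^r$ if $\Delta_M(M)\subset M\otimes k[T]_{<p^r}$. Let $u_s$ be the functional taking the coefficient of $T^{p^s}$. The action of $\mathbb G_a$ on $M$ at $\sigma_{\underline a}$ is that of $\sum_s(\sigma_{a_s})_*(u_s)=\sum_sa_s^{p^s}u_s$, where $\sigma_b$ is multiplication by $b$; the action of $\mathbb G_{a(r)}$ at $\mu_{\underline b}$ is that of $(\mu_{\underline b})_*(u_{r-1})$. The $j$-rank of an operator is the rank of its $j$-th power. Let $V(\mathbb G_a)_M$ be the set of those $\sigma_{\underline a}$ at which the action does not make $M$ a free $k[u]/u^p$-module. For $1\le j<p$ let $V^j(\mathbb G_a)_M\subset V(\mathbb G_a)$ consist of $\sigma_{\underline 0}$ and of those $\sigma_{\underline a}$ at which the $j$-rank of the action on $M$ is not maximal among all points of $V(\mathbb G_a)$, and let $V^j_r(\mathbb G_a)_M(k)\subset V_r(\mathbb G_a)(k)$ consist of $\mu_{\underline 0}$ and of those $\mu_{\underline b}$ at which the $j$-rank of the action is not maximal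 among all points of $V_r(\mathbb G_a)(k)$. The restriction of $M$ to $\mathbb G_{a(r)}$ has constant $j$-rank if the $j$-rank of $\mu_*(u_{r-1})$ on $M\otimes_kL$ is the same for all field extensions $L/k$ and all nontrivial homomorphisms $\mu:\mathbb G_{a(r),L}\to\mathbb G_{a,L}$. Theorem. For every $j$ with $1\le j<p$: (1) Let $r>0$ be such that $M$ has degree $<p^r$. Then $$V^j(\mathbb G_a)_M\cup pr_r^{-1}(\mu_{\underline 0})=pr_r^{-1}(\lambda_{r,r}(V^j_r(\mathbb G_a)_M(k))),$$ and $V^j(\mathbb G_a)_M=pr_r^{-1}(\lambda_{r,r}(V^j_r(\mathbb G_a)_M(k)))$ holds if and only if the action at some $\sigma_{\underline a}$ has nonzero $j$-th power on $M$. (2) $V^j(\mathbb G_a)_M$ is a proper closed subset of $V(\mathbb G_a)$. (3) If $M\ne0$, then $V^j(\mathbb G_a)_M\subset V(\mathbb G_a)_M$, with equality if and only if the action of $\mathbb G_a$ on $M$ at some $\sigma_{\underline a}$ has all Jordan blocks of size $p$. (4) Let $r>0$. If $V^j(\mathbb G_a)_M\cap\{\sigma_{\underline a}:\underline a\ne0,\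 a_s=0\text{ for }s\ge r\}=\emptyset$, then the restriction of $M$ to $\mathbb G_{a(r)}$ has constant $j$-rank. If $M$ has degree $<p^r$, the converse holds as well. -/

import Mathlib

open scoped TensorProduct Polynomial Topology

universe u v

noncomputable section

/-! ### The additive group and its Frobenius kernels, through their coordinate Hopf algebras -/

/-- The comultiplication `T ↦ T ⊗ 1 + 1 ⊗ T` of the coordinate algebra `K[T]` of the additive
group over `K`. -/
def gaComul (K : Type u) [Field K] : K[X] →ₐ[K] K[X] ⊗[K] K[X] :=
  Polynomial.aeval (Polynomial.X ⊗ₜ[K] 1 + 1 ⊗ₜ[K] Polynomial.X)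

/-- The counit `T ↦ 0` of `K[T]`. -/
def gaCounit (K : Type u) [Field K] : K[X] →ₐ[K] K :=
  Polynomial.aeval 0

theorem add_pow_prime_pow_of_algebra (K : Type u) [Field K] (p : ℕ) [Fact p.Prime] [CharP K p]
    {A : Type v} [CommRing A] [Algebra K A] (n : ℕ) (x y : A) :
    (x + y) ^ p ^ n = x ^ p ^ n + y ^ p ^ n := by
  rcases subsingleton_or_nontrivial A with h | h
  · exact Subsingleton.elim _ _
  · have : CharP A p := charP_of_injective_algebraMap (algebraMap K A).injective p
    exact add_pow_char_pow x y p n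

/-- The coordinate algebra `K[T] / (T ^ (p ^ r))` of the `r`-th Frobenius kernel of the additive
group. -/
abbrev FrobCoord (p r : ℕ) (K : Type u) [Field K] : Type u :=
  AdjoinRoot (Polynomial.X ^ p ^ r : K[X])

theorem frobCoord_root_pow (p r : ℕ) (K : Type u) [Field K] :
    (AdjoinRoot.root (Polynomial.X ^ p ^ r : K[X])) ^ p ^ r = 0 := by
  have h := AdjoinRoot.mk_self (f := (Polynomial.X ^ p ^ r : K[X]))
  rwa [map_pow, AdjoinRoot.mk_X] at h

/-- The comultiplication `T ↦ T ⊗ 1 + 1 ⊗ T` of `K[T] / (T ^ (p ^ r))`. -/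
def frobComul (p r : ℕ) (K : Type u) [Field K] [Fact p.Prime] [CharP K p] :
    FrobCoord p r K →ₐ[K] FrobCoord p r K ⊗[K] FrobCoord p r K :=
  AdjoinRoot.liftAlgHom _ (Algebra.ofId K _)
    (AdjoinRoot.root _ ⊗ₜ[K] 1 + 1 ⊗ₜ[K] AdjoinRoot.root _) (by
      rw [Polynomial.eval₂_X_pow, add_pow_prime_pow_of_algebra K p,
        Algebra.TensorProduct.tmul_pow, Algebra.TensorProduct.tmul_pow, frobCoord_root_pow,
        TensorProduct.zero_tmul, TensorProduct.tmul_zero, add_zero])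

theorem frobComul_root (p r : ℕ) (K : Type u) [Field K] [Fact p.Prime] [CharP K p] :
    frobComul p r K (AdjoinRoot.root _) =
      AdjoinRoot.root _ ⊗ₜ[K] 1 + 1 ⊗ₜ[K] AdjoinRoot.root _ := by
  simp [frobComul]

/-- The coefficient of `T ^ i` (for `i < p ^ r`) on `K[T] / (T ^ (p ^ r))`, read off on the
representative of degree `< p ^ r`. -/
def frobCoeff (p r : ℕ) (K : Type u) [Field K] (i : ℕ) : FrobCoord p r K →ₗ[K] K :=
  (Polynomial.lcoeff K i).comp (AdjoinRoot.modByMonicHom (Polynomial.monic_X_pow (p ^ r)))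

/-! ### One-parameter subgroups -/

/-- A 1-parameter subgroup of the additive group: a homomorphism of group schemes from the
additive group to itself, given by its map of coordinate algebras. -/
@[ext]
structure GaOneParam (K : Type u) [Field K] where
  /-- the map of coordinate algebras -/
  comap : K[X] →ₐ[K] K[X]
  comap_comul : (gaComul K).comp comap =
    (Algebra.TensorProduct.map comap comap).comp (gaComul K)

/-- An infinitesimal 1-parameter subgroup of height `r` of the additive group over `K`: a
homomorphism of group schemes from the `r`-th Frobenius kernel of the additive group to the
additive group, given by its map of coordinate algebras. -/
@[ext]
structure GaInfOneParam (p r : ℕ) (K : Type u) [Field K] [Fact p.Prime] [CharP K p] where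
  /-- the map of coordinate algebras -/
  comap : K[X] →ₐ[K] FrobCoord p r K
  comap_comul : (frobComul p r K).comp comap =
    (Algebra.TensorProduct.map comap comap).comp (gaComul K)

namespace GaOneParam

/-- The sequence `(a_0, a_1, …)` of a 1-parameter subgroup `σ`, where `σ` is given by
`T ↦ ∑ s, a_s T ^ (p ^ s)`. -/
def coords (p : ℕ) [Fact p.Prime] {K : Type u} [Field K] (σ : GaOneParam K) : ℕ →₀ K :=
  Finsupp.comapDomain (fun s : ℕ => p ^ s) (σ.comap Polynomial.X).toFinsupp.coeff
    (Nat.pow_right_injective (Fact.out : p.Prime).two_le).injOn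

/-- The 1-parameter subgroup given by multiplication by `b`. -/
def scaling {K : Type u} [Field K] (b : K) : GaOneParam K where
  comap := Polynomial.aeval (b • Polynomial.X)
  comap_comul := by
    ext
    simp [gaComul, smul_add, TensorProduct.smul_tmul']

/-- The pushforward along `σ` of a linear functional on the coordinate algebra. -/
def push {K : Type u} [Field K] (σ : GaOneParam K) (φ : K[X] →ₗ[K] K) : K[X] →ₗ[K] K :=
  φ.comp σ.comap.toLinearMap

/-- The element `∑ s, (σ_{a_s})_* (u_s)` of the group algebra of the additive group, as a
functional on `K[T]`; here `(a_0, a_1, …)` is the sequence of `σ` and `u_s` is the coefficient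
of `T ^ (p ^ s)`. -/
def element (p : ℕ) [Fact p.Prime] {K : Type u} [Field K] (σ : GaOneParam K) : K[X] →ₗ[K] K :=
  (σ.coords p).sum fun s b => (scaling b).push (Polynomial.lcoeff K (p ^ s))

/-- Restriction of a 1-parameter subgroup to the `r`-th Frobenius kernel. -/
def pr (p r : ℕ) [Fact p.Prime] {K : Type u} [Field K] [CharP K p] (σ : GaOneParam K) :
    GaInfOneParam p r K where
  comap := (AdjoinRoot.mkₐ _).comp σ.comap
  comap_comul := by
    have h : (frobComul p r K).comp (AdjoinRoot.mkₐ _) =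
        (Algebra.TensorProduct.map (AdjoinRoot.mkₐ _) (AdjoinRoot.mkₐ _)).comp (gaComul K) := by
      ext
      simp [gaComul, frobComul_root]
    rw [← AlgHom.comp_assoc, h, AlgHom.comp_assoc, σ.comap_comul, ← AlgHom.comp_assoc,
      ← Algebra.TensorProduct.map_comp]

end GaOneParam

namespace GaInfOneParam

variable {p r : ℕ} [Fact p.Prime] {K : Type u} [Field K] [CharP K p]

/-- The tuple `(b_0, …, b_{r-1})` of an infinitesimal 1-parameter subgroup given by
`T ↦ ∑ s < r, b_s T ^ (p ^ s)`. -/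
def coords (μ : GaInfOneParam p r K) : Fin r → K :=
  fun s => frobCoeff p r K (p ^ (s : ℕ)) (μ.comap Polynomial.X)

variable (p) in
/-- The infinitesimal 1-parameter subgroup `T ↦ ∑ s < r, b_s T ^ (p ^ s)`. -/
def ofCoords (b : Fin r → K) : GaInfOneParam p r K where
  comap := Polynomial.aeval (∑ s, b s • AdjoinRoot.root (Polynomial.X ^ p ^ r : K[X]) ^ p ^ (s : ℕ))
  comap_comul := by
    ext
    simp [gaComul, frobComul_root, add_pow_prime_pow_of_algebra K p,
      Algebra.TensorProduct.tmul_pow, smul_add, Finset.sum_add_distrib, TensorProduct.sum_tmul,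
      TensorProduct.tmul_sum, TensorProduct.smul_tmul']

/-- The involution `(b_0, …, b_{r-1}) ↦ (b_{r-1}, …, b_0)`. -/
def reverse (μ : GaInfOneParam p r K) : GaInfOneParam p r K :=
  ofCoords p fun s => μ.coords s.rev

/-- The functional `μ_* (u_{r-1})` on `K[T]`; here `u_{r-1}` is the coefficient of
`T ^ (p ^ (r - 1))` on the coordinate algebra of the `r`-th Frobenius kernel, `r > 0`. -/
def element (μ : GaInfOneParam p r K) : K[X] →ₗ[K] K :=
  (frobCoeff p r K (p ^ (r - 1))).comp μ.comap.toLinearMap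

end GaInfOneParam

/-! ### Topologies -/

/-- The Zariski topology on `K ^ n`: a basis is given by the non-vanishing loci of polynomials. -/
abbrev affineZariski (n : ℕ) (K : Type u) [Field K] : TopologicalSpace (Fin n → K) :=
  TopologicalSpace.generateFrom
    {U | ∃ f : MvPolynomial (Fin n) K, U = {a | MvPolynomial.eval a f ≠ 0}}

/-- The Zariski topology on the `K`-points of the scheme of infinitesimal 1-parameter subgroups of
height `r` of the additive group, which is an affine space with coordinates `b_0, …, b_{r-1}`. -/
abbrev infZariski (p r : ℕ) (K : Type u) [Field K] [Fact p.Prime] [CharP K p] :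
    TopologicalSpace (GaInfOneParam p r K) :=
  (affineZariski r K).induced GaInfOneParam.coords

/-- The topology on the 1-parameter subgroups of the additive group: the weakest one for which all
restrictions to Frobenius kernels are continuous. -/
abbrev gaTopology (p : ℕ) (K : Type u) [Field K] [Fact p.Prime] [CharP K p] :
    TopologicalSpace (GaOneParam K) :=
  ⨅ (r : ℕ) (_ : 0 < r), (infZariski p r K).induced (GaOneParam.pr p r)

/-! ### Linear operators -/

/-- The `j`-rank of an endomorphism: the rank of its `j`-th power. -/
def jRank {K : Type u} [Field K] {M : Type v} [AddCommGroup M] [Module K M] (j : ℕ)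
    (f : Module.End K M) : ℕ :=
  Module.finrank K (LinearMap.range (f ^ j))

/-- `f ^ p = 0`, and the `K[t] / (t ^ p)`-module on which `t` acts as `f` is free: it has a family
`m` such that the elements `f ^ s (m i)` with `s < p` form a `K`-basis. -/
def ActsFreely (p : ℕ) {K : Type u} [Field K] {M : Type v} [AddCommGroup M] [Module K M]
    (f : Module.End K M) : Prop :=
  f ^ p = 0 ∧ ∃ (ι : Type v) (m : ι → M) (b : Module.Basis (ι × Fin p) K M),
    ∀ (i : ι) (s : Fin p), b (i, s) = (f ^ (s : ℕ)) (m i)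

/-- The endomorphism `f` is nilpotent and its Jordan canonical form has `n` blocks, of sizes
`ℓ 0, …, ℓ (n - 1)`. -/
def HasJordanBlocks {K : Type u} [Field K] {M : Type v} [AddCommGroup M] [Module K M]
    (f : Module.End K M) {n : ℕ} (ℓ : Fin n → ℕ) : Prop :=
  (∀ i, 0 < ℓ i) ∧ ∃ b : Module.Basis (Σ i : Fin n, Fin (ℓ i)) K M,
    ∀ (i : Fin n) (s : Fin (ℓ i)),
      f (b ⟨i, s⟩) = if h : (s : ℕ) + 1 < ℓ i then b ⟨i, ⟨s + 1, h⟩⟩ else 0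

/-! ### Rational modules and their invariants -/

/-- A rational module for the additive group over `K`: a right comodule for `K[T]`. -/
structure RationalGaModule (K : Type u) [Field K] (M : Type v) [AddCommGroup M] [Module K M] where
  /-- the coaction -/
  coaction : M →ₗ[K] M ⊗[K] K[X]
  coassoc : (TensorProduct.assoc K M K[X] K[X]).toLinearMap.comp
      ((coaction.rTensor K[X]).comp coaction) =
    ((gaComul K).toLinearMap.lTensor M).comp coaction
  counit : (TensorProduct.rid K M).toLinearMap.comp
      (((gaCounit K).toLinearMap.lTensor M).comp coaction) = LinearMap.id

namespace RationalGaModule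

variable {K : Type u} [Field K] {M : Type v} [AddCommGroup M] [Module K M]

/-- The module has degree `< d`: the coaction takes values in `M ⊗ K[T]_{< d}`. -/
def HasDegreeLT (ρ : RationalGaModule K M) (d : ℕ) : Prop :=
  ∀ m, ρ.coaction m ∈ LinearMap.range ((Polynomial.degreeLT K d).subtype.lTensor M)

/-- The action on `M` of a functional `φ` on the coordinate algebra `K[T]`, which sends `m` to
`(id ⊗ φ) (Δ m)`. -/
def act (ρ : RationalGaModule K M) (φ : K[X] →ₗ[K] K) : Module.End K M :=
  (TensorProduct.rid K M).toLinearMap.comp ((φ.lTensor M).comp ρ.coaction)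

/-- The action on `L ⊗ M` of a functional on `L[T]`, for a field extension `L` of `K`; this is the
action `act` for the base change of `M` to `L`. -/
def actBaseChange (ρ : RationalGaModule K M) (L : Type u) [Field L] [Algebra K L]
    (φ : L[X] →ₗ[L] L) : Module.End L (L ⊗[K] M) :=
  LinearMap.liftBaseChange L ((TensorProduct.comm K M L).toLinearMap.comp
    (((φ.restrictScalars K).comp
      (Polynomial.mapAlgHom (Algebra.ofId K L)).toLinearMap).lTensor M ∘ₗ ρ.coaction))

variable (p : ℕ) [Fact p.Prime]

/-- The action of the additive group on `M` at the 1-parameter subgroup `σ`, that is, the action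
of `∑ s, (σ_{a_s})_* (u_s)`. -/
def actionAt (ρ : RationalGaModule K M) (σ : GaOneParam K) : Module.End K M :=
  ρ.act (σ.element p)

/-- The action of the `r`-th Frobenius kernel on `M` at the infinitesimal 1-parameter subgroup `μ`,
that is, the action of `μ_* (u_{r-1})`. -/
def frobActionAt {p} [Fact p.Prime] [CharP K p] (ρ : RationalGaModule K M) {r : ℕ}
    (μ : GaInfOneParam p r K) : Module.End K M :=
  ρ.act μ.element

/-- The support variety of `M`. -/
def supportVariety (ρ : RationalGaModule K M) : Set (GaOneParam K) :=
  {σ | ¬ ActsFreely p (ρ.actionAt p σ)}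

/-- The non-maximal `j`-rank variety of `M`. -/
def nonMaxVariety (ρ : RationalGaModule K M) (j : ℕ) : Set (GaOneParam K) :=
  {σ | σ.coords p = 0 ∨ ∃ τ, jRank j (ρ.actionAt p σ) < jRank j (ρ.actionAt p τ)}

/-- The restriction of `M` to the `r`-th Frobenius kernel has constant `j`-rank: the action
`μ_* (u_{r-1})` on the base change of `M` has the same `j`-rank for all non-zero infinitesimal
1-parameter subgroups `μ` over all field extensions `L` of `K`. -/
def HasConstantJRank (ρ : RationalGaModule K M) (r j : ℕ) : Prop :=
  ∃ c : ℕ, ∀ (L : Type u) [Field L] [Algebra K L] [CharP L p] (μ : GaInfOneParam p r L),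
    μ.coords ≠ 0 → jRank j (ρ.actBaseChange L μ.element) = c

variable [CharP K p]

/-- The non-maximal `j`-rank variety of the restriction of `M` to the `r`-th Frobenius kernel
(its `K`-points). -/
def frobNonMaxVariety (ρ : RationalGaModule K M) (r j : ℕ) : Set (GaInfOneParam p r K) :=
  {μ | μ.coords = 0 ∨ ∃ ν : GaInfOneParam p r K,
    jRank j (ρ.frobActionAt μ) < jRank j (ρ.frobActionAt ν)}

end RationalGaModule

end

/-! Write `D n` for the coefficient of `T ^ n` in the coaction. The comodule axioms say that the `D
n` multiply like divided powers `t ^ n / n!`. The action of the additive group at `σ` is the linear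
combination of the `D (p ^ s)` with coefficients `a_s ^ p ^ s`. Since `k` has all `p ^ s`-th roots,
these are exactly the linear combinations of the `D (p ^ s)`. The action of the Frobenius kernel at
the reversed tuple has the same linear part. Its other terms involve `D n` with `n > 0` not a power
of `p`; by Lucas such a `D n` is a scalar times `D (p ^ i) * D (n - p ^ i)`, with nilpotent second
factor.

Everything therefore rests on one comparison (`jRank_perturb`): such nilpotent perturbations respect
both the bound `R`, the maximal `j`-rank of the linear combinations, and the property of attaining
it. Adding one term at a time reduces this to a pencil `α + c β` and the operator `α + γ β`, where
`γ` is nilpotent and commutes with `α` and `β`. Let `C` be the cokernel of `(α + X β) ^ j` on `K[X]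
⊗ V`. The cokernels of `(α + c β) ^ j` and `(α + γ β) ^ j` are the quotients of `C` by the images of
`X - c` and `X - γ`. The torsion-free part of `C` contributes its rank to the dimension of each. The
torsion part contributes nothing for some `c`, and if it contributes nothing for `X`, then `X` is
invertible on it, hence so is `X - γ` (`length_coker_xSubEnd_of_eq`, `exists_corank_pencil`).

This comparison (`jRank_frobActionAt`) gives the first assertion. Closedness holds because bounds on
the rank are polynomial conditions, namely the vanishing of minors. The relation to the support
variety comes from the inequality `p * rank (f ^ j) ≤ (p - j) * dim` when `f ^ p = 0`, with equality
exactly for free actions (`actsFreely_iff`). For constant `j`-rank, the comparison is made over each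
extension field `L`; the Nullstellensatz carries the lower bound on linear parts from `k` to `L`
(`le_jRank_baseChange`). -/

noncomputable section

/-! ### Cokernels of endomorphisms of modules over a polynomial ring in one variable -/

section Cokernel

variable {K : Type*} [Field K]

/-- The dimension of the cokernel is additive in short exact sequences of vector spaces with
endomorphisms, if the endomorphism of the last term is injective. -/
theorem length_coker_eq_add {A B C : Type*} [AddCommGroup A] [Module K A] [AddCommGroup B]
    [Module K B] [AddCommGroup C] [Module K C] (f : A →ₗ[K] B) (g : B →ₗ[K] C)
    (hf : Function.Injective f) (hg : Function.Surjective g) (hfg : Function.Exact f g)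
    (a : Module.End K A) (b : Module.End K B) (c : Module.End K C)
    (hab : ∀ x, f (a x) = b (f x)) (hbc : ∀ x, g (b x) = c (g x)) (hc : Function.Injective c) :
    Module.length K (B ⧸ LinearMap.range b) =
      Module.length K (A ⧸ LinearMap.range a) + Module.length K (C ⧸ LinearMap.range c) := by
  have h1 : LinearMap.range a ≤ (LinearMap.range b).comap f := by
    rintro _ ⟨x, rfl⟩
    exact ⟨f x, (hab x).symm⟩
  have h2 : LinearMap.range b ≤ (LinearMap.range c).comap g := by
    rintro _ ⟨x, rfl⟩
    exact ⟨g x, (hbc x).symm⟩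
  refine Module.length_eq_add_of_exact (Submodule.mapQ _ _ f h1) (Submodule.mapQ _ _ g h2) ?_ ?_ ?_
  · rw [← LinearMap.ker_eq_bot, LinearMap.ker_eq_bot']
    intro y hy
    obtain ⟨x, rfl⟩ := Submodule.mkQ_surjective _ y
    simp only [Submodule.mkQ_apply, Submodule.mapQ_apply, Submodule.Quotient.mk_eq_zero] at hy ⊢
    obtain ⟨z, hz⟩ := hy
    -- Injectivity of `c` kills the connecting map `ker c → coker a` of the snake lemma.
    have hgz : g z = 0 := hc (by rw [← hbc, hz, hfg.apply_apply_eq_zero, map_zero])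
    obtain ⟨w, rfl⟩ := (hfg z).1 hgz
    exact ⟨w, hf (by rw [hab, hz])⟩
  · intro y
    obtain ⟨x, rfl⟩ := Submodule.mkQ_surjective _ y
    obtain ⟨z, rfl⟩ := hg x
    exact ⟨Submodule.Quotient.mk z, by simp⟩
  · intro y
    obtain ⟨x, rfl⟩ := Submodule.mkQ_surjective _ y
    constructor
    · intro h
      simp only [Submodule.mkQ_apply, Submodule.mapQ_apply, Submodule.Quotient.mk_eq_zero] at h
      obtain ⟨z, hz⟩ := h
      obtain ⟨w, rfl⟩ := hg z
      obtain ⟨t, ht⟩ := (hfg (x - b w)).1 (by rw [map_sub, hbc, hz, sub_self])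
      refine ⟨Submodule.Quotient.mk t, ?_⟩
      simp only [Submodule.mkQ_apply, Submodule.mapQ_apply, ht]
      rw [Submodule.Quotient.eq]
      exact ⟨-w, by simp⟩
    · rintro ⟨z, hz⟩
      obtain ⟨w, rfl⟩ := Submodule.mkQ_surjective _ z
      rw [← hz]
      simp [hfg.apply_apply_eq_zero]

variable (C : Type*) [AddCommGroup C] [Module K[X] C]

/-- Multiplication by `X - c`, minus the endomorphism `θ`. -/
def xSubEnd {C : Type*} [AddCommGroup C] [Module K[X] C] (c : K) (θ : Module.End K[X] C) :
    Module.End K[X] C :=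
  (Polynomial.X - Polynomial.C c) • (1 : Module.End K[X] C) - θ

variable {C}

theorem xSubEnd_apply (c : K) (θ : Module.End K[X] C) (x : C) :
    xSubEnd c θ x = (Polynomial.X - Polynomial.C c) • x - θ x := by
  simp [xSubEnd]

/-- On the kernel `X - c` acts as `θ`, so a power of the nonzero polynomial `X - c` kills it, which
torsion-freeness forbids. -/
theorem xSubEnd_injective [Module.IsTorsionFree K[X] C] (c : K) (θ : Module.End K[X] C)
    (hθ : IsNilpotent θ) : Function.Injective (xSubEnd c θ) := by
  rw [← LinearMap.ker_eq_bot, LinearMap.ker_eq_bot']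
  intro x hx
  rw [xSubEnd_apply, sub_eq_zero] at hx
  have h : ∀ n : ℕ, (Polynomial.X - Polynomial.C c) ^ n • x = (θ ^ n) x := by
    intro n
    induction n with
    | zero => simp
    | succ n ih => rw [pow_succ', mul_smul, ih, ← map_smul, hx, pow_succ, Module.End.mul_apply]
  obtain ⟨n, hn⟩ := hθ
  have := h n
  rw [hn, LinearMap.zero_apply] at this
  exact (smul_eq_zero.1 this).resolve_left (pow_ne_zero _ (Polynomial.X_sub_C_ne_zero c))

variable [Module K C] [IsScalarTower K K[X] C]

/-- In a basis, evaluation of the coordinates at `c` is surjective onto a space of dimension the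
rank, and its kernel consists of the multiples of `X - c`. -/
theorem length_coker_X_sub_C_of_free [Module.Finite K[X] C] [Module.Free K[X] C] (c : K) :
    Module.length K (C ⧸ LinearMap.range ((xSubEnd c (0 : Module.End K[X] C)).restrictScalars K)) =
      Module.finrank K[X] C := by
  let b := Module.finBasis K[X] C
  let ev : C →ₗ[K] (Fin (Module.finrank K[X] C) → K) :=
    LinearMap.pi fun i => (Polynomial.leval c).comp ((b.coord i).restrictScalars K)
  have hev : Function.Surjective ev := by
    intro y
    refine ⟨b.equivFun.symm fun i => Polynomial.C (y i), ?_⟩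
    ext i
    simp only [ev, LinearMap.pi_apply, LinearMap.comp_apply, LinearMap.restrictScalars_apply,
      Module.Basis.coord_apply, Polynomial.leval_apply]
    rw [← Module.Basis.equivFun_apply, LinearEquiv.apply_symm_apply, Polynomial.eval_C]
  have hker : LinearMap.ker ev =
      LinearMap.range ((xSubEnd c (0 : Module.End K[X] C)).restrictScalars K) := by
    ext x
    constructor
    · intro hx
      have hd : ∀ i, ∃ q : K[X], b.coord i x = (Polynomial.X - Polynomial.C c) * q := by
        intro i
        exact Polynomial.dvd_iff_isRoot.2 (congrFun hx i)
      choose q hq using hd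
      refine ⟨b.equivFun.symm q, b.ext_elem fun i => ?_⟩
      rw [LinearMap.restrictScalars_apply, xSubEnd_apply, LinearMap.zero_apply, sub_zero,
        map_smul, Finsupp.smul_apply, ← Module.Basis.equivFun_apply b (b.equivFun.symm q),
        LinearEquiv.apply_symm_apply]
      exact (hq i).symm
    · rintro ⟨y, rfl⟩
      ext i
      simp [ev, xSubEnd_apply]
  rw [← hker, LinearEquiv.length_eq (ev.quotKerEquivOfSurjective hev), Module.length_eq_finrank]
  simp

/-- Induction on the nilpotency index along `0 → ker θ → C → im θ → 0`. On `ker θ`, which is free as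
a finite torsion-free module over a principal ideal domain, `θ` is zero; on `im θ` the index drops
by one. Both cokernel dimension and rank are additive. -/
theorem length_coker_xSubEnd_of_torsionFree [Module.Finite K[X] C] [Module.IsTorsionFree K[X] C]
    (c : K) (n : ℕ) (θ : Module.End K[X] C) (hθ : θ ^ n = 0) :
    Module.length K (C ⧸ LinearMap.range ((xSubEnd c θ).restrictScalars K)) =
      Module.finrank K[X] C := by
  induction n generalizing C with
  | zero =>
    have h1 : (1 : Module.End K[X] C) = 0 := by simpa using hθ
    have : Subsingleton C := ⟨fun x y => by
      rw [← Module.End.one_apply (R := K[X]) x, ← Module.End.one_apply (R := K[X]) y, h1]; simp⟩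
    rw [Module.finrank_zero_of_subsingleton, Module.length_eq_zero_iff.2]
    · rfl
    · exact Quot.Subsingleton
  | succ n ih =>
    have hs : ∀ x : C, θ x ∈ LinearMap.range θ := fun x => ⟨x, rfl⟩
    let θ' : Module.End K[X] (LinearMap.range θ) := θ.restrict fun x _ => hs x
    have hθ' : θ' ^ n = 0 := by
      ext ⟨_, x, rfl⟩
      have := congrArg (fun f : Module.End K[X] C => f x) hθ
      simp only [pow_succ, Module.End.mul_apply, LinearMap.zero_apply] at this
      rw [Module.End.pow_restrict]
      simp only [LinearMap.zero_apply]
      exact this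
    have h1 := length_coker_eq_add ((LinearMap.ker θ).subtype.restrictScalars K)
      (θ.rangeRestrict.restrictScalars K) (Submodule.subtype_injective _)
      (LinearMap.surjective_rangeRestrict _) (fun x => by simp [Subtype.ext_iff])
      ((xSubEnd c (0 : Module.End K[X] (LinearMap.ker θ))).restrictScalars K)
      ((xSubEnd c θ).restrictScalars K) ((xSubEnd c θ').restrictScalars K)
      (fun x => by simp [xSubEnd_apply]) (fun x => by
        simp [xSubEnd_apply, θ', Subtype.ext_iff]) (xSubEnd_injective c θ' ⟨n, hθ'⟩)
    have : Module.Free K[X] (LinearMap.ker θ) := Module.free_of_finite_type_torsion_free'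
    rw [h1, ih θ' hθ', length_coker_X_sub_C_of_free]
    have h2 := Submodule.finrank_quotient_add_finrank (LinearMap.ker θ)
    rw [LinearEquiv.finrank_eq θ.quotKerEquivRange] at h2
    rw [← h2, Nat.cast_add, add_comm]

/-- The endomorphism induced on the torsion submodule. -/
def torsionRestrict (θ : Module.End K[X] C) : Module.End K[X] (Submodule.torsion K[X] C) :=
  θ.restrict fun x hx => by
    obtain ⟨a, ha⟩ := (Submodule.mem_torsion_iff x).1 hx
    exact (Submodule.mem_torsion_iff _).2 ⟨a, by
      rw [Submonoid.smul_def, ← map_smul, ← Submonoid.smul_def, ha, map_zero]⟩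

omit [Module K C] [IsScalarTower K K[X] C] in
theorem isNilpotent_torsionRestrict (θ : Module.End K[X] C) (hθ : IsNilpotent θ) :
    IsNilpotent (torsionRestrict θ) := by
  obtain ⟨n, hn⟩ := hθ
  refine ⟨n, ?_⟩
  ext x
  simp [torsionRestrict, Module.End.pow_restrict, hn]

theorem length_coker_xSubEnd_of_exact {A F : Type*} [AddCommGroup A] [Module K[X] A] [Module K A]
    [IsScalarTower K K[X] A] [AddCommGroup F] [Module K[X] F] [Module K F] [IsScalarTower K K[X] F]
    [Module.Finite K[X] F] [Module.IsTorsionFree K[X] F] (f : A →ₗ[K[X]] C) (g : C →ₗ[K[X]] F)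
    (hf : Function.Injective f) (hg : Function.Surjective g) (hfg : Function.Exact f g)
    (c : K) (θA : Module.End K[X] A) (θ : Module.End K[X] C) (θF : Module.End K[X] F)
    (hA : ∀ x, f (θA x) = θ (f x)) (hF : ∀ x, g (θ x) = θF (g x)) (hθ : IsNilpotent θ) :
    Module.length K (C ⧸ LinearMap.range ((xSubEnd c θ).restrictScalars K)) =
      Module.length K (A ⧸ LinearMap.range ((xSubEnd c θA).restrictScalars K)) +
      Module.finrank K[X] F := by
  have hp : ∀ (n : ℕ) (x : C), (θF ^ n) (g x) = g ((θ ^ n) x) := by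
    intro n x
    induction n generalizing x with
    | zero => rfl
    | succ n ih => rw [pow_succ, pow_succ, Module.End.mul_apply, Module.End.mul_apply, ← ih, hF]
  obtain ⟨n, hn⟩ := hθ
  have hθF : θF ^ n = 0 := by
    ext y
    obtain ⟨x, rfl⟩ := hg y
    simp [hp, hn]
  rw [← length_coker_xSubEnd_of_torsionFree c n θF hθF]
  exact length_coker_eq_add (f.restrictScalars K) (g.restrictScalars K) hf hg hfg _ _ _
    (fun x => by simp [xSubEnd_apply, hA]) (fun x => by simp [xSubEnd_apply, hF])
    (xSubEnd_injective c θF ⟨n, hθF⟩)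

/-- Only the torsion part can make the dimension depend on `c` and `θ`; the torsion-free quotient
always contributes its rank. -/
theorem length_coker_xSubEnd [Module.Finite K[X] C] (c : K) (θ : Module.End K[X] C)
    (hθ : IsNilpotent θ) :
    Module.length K (C ⧸ LinearMap.range ((xSubEnd c θ).restrictScalars K)) =
      Module.length K (Submodule.torsion K[X] C ⧸
        LinearMap.range ((xSubEnd c (torsionRestrict θ)).restrictScalars K)) +
      Module.finrank K[X] (C ⧸ Submodule.torsion K[X] C) := by
  have htf : Module.IsTorsionFree K[X] (C ⧸ Submodule.torsion K[X] C) :=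
    Submodule.isTorsionFree_iff_torsion_eq_bot.2 Submodule.QuotientTorsion.torsion_eq_bot
  exact length_coker_xSubEnd_of_exact (Submodule.torsion K[X] C).subtype
    (Submodule.torsion K[X] C).mkQ (Submodule.subtype_injective _) (Submodule.mkQ_surjective _)
    (LinearMap.exact_subtype_mkQ _) c _ θ
    (Submodule.mapQ _ _ θ fun x hx => (torsionRestrict θ ⟨x, hx⟩).2)
    (fun _ => rfl) (fun _ => rfl) hθ

/-- If the dimension of the cokernel of `X - c` is the rank, then so is that of `X - c - θ`
for every nilpotent endomorphism `θ`. -/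
theorem length_coker_xSubEnd_of_eq [Module.Finite K[X] C] (c : K) (θ : Module.End K[X] C)
    (hθ : IsNilpotent θ)
    (h : Module.length K
        (C ⧸ LinearMap.range ((xSubEnd c (0 : Module.End K[X] C)).restrictScalars K)) =
      Module.finrank K[X] (C ⧸ Submodule.torsion K[X] C)) :
    Module.length K (C ⧸ LinearMap.range ((xSubEnd c θ).restrictScalars K)) =
      Module.finrank K[X] (C ⧸ Submodule.torsion K[X] C) := by
  rw [length_coker_xSubEnd c 0 IsNilpotent.zero] at h
  have h0 : Module.length K (Submodule.torsion K[X] C ⧸ LinearMap.range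
      ((xSubEnd c (torsionRestrict (0 : Module.End K[X] C))).restrictScalars K)) = 0 := by
    exact WithTop.add_right_cancel (ENat.natCast_ne_top _) (h.trans (zero_add _).symm)
  have hz : torsionRestrict (0 : Module.End K[X] C) = 0 := by
    ext x; simp [torsionRestrict]
  rw [Module.length_eq_zero_iff, Submodule.Quotient.subsingleton_iff,
    LinearMap.range_eq_top, hz] at h0
  -- A surjective endomorphism of a Noetherian module is injective, so `X - c` is invertible on
  -- torsion; subtracting a commuting nilpotent keeps it so.
  have h1 : IsUnit (xSubEnd c (0 : Module.End K[X] (Submodule.torsion K[X] C))) :=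
    (Module.End.isUnit_iff _).2 ⟨IsNoetherian.injective_of_surjective_endomorphism _ h0, h0⟩
  have h2 : IsUnit (xSubEnd c (torsionRestrict θ)) := by
    have hc : Commute (-torsionRestrict θ)
        (xSubEnd c (0 : Module.End K[X] (Submodule.torsion K[X] C))) := by
      rw [commute_iff_eq]
      ext x
      simp [xSubEnd_apply]
    have h3 := IsNilpotent.isUnit_add_left_of_commute
      (R := Module.End K[X] (Submodule.torsion K[X] C))
      (isNilpotent_torsionRestrict θ hθ).neg h1 hc
    have h4 : xSubEnd c (torsionRestrict θ) =
        xSubEnd c (0 : Module.End K[X] (Submodule.torsion K[X] C)) + -torsionRestrict θ := by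
      refine LinearMap.ext fun x => ?_
      rw [LinearMap.add_apply, LinearMap.neg_apply, xSubEnd_apply, xSubEnd_apply,
        LinearMap.zero_apply, sub_zero, sub_eq_add_neg]
    rwa [h4]
  rw [length_coker_xSubEnd c θ hθ, Module.length_eq_zero_iff.2, zero_add]
  rw [Submodule.Quotient.subsingleton_iff, LinearMap.range_eq_top]
  exact ((Module.End.isUnit_iff _).1 h2).2

/-- Over an infinite field, the dimension of the cokernel of `X - c` is the rank for some `c`. -/
theorem exists_length_coker_X_sub_C_eq [Infinite K] [Module.Finite K[X] C] :
    ∃ c : K, Module.length K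
        (C ⧸ LinearMap.range ((xSubEnd c (0 : Module.End K[X] C)).restrictScalars K)) =
      Module.finrank K[X] (C ⧸ Submodule.torsion K[X] C) := by
  obtain ⟨q, hq, hq0⟩ := Submodule.annihilator_top_inter_nonZeroDivisors
    (Submodule.torsion_isTorsion (R := K[X]) (M := C))
  obtain ⟨c, hc⟩ : ∃ c : K, q.eval c ≠ 0 := by
    by_contra! h
    exact nonZeroDivisors.ne_zero hq0 (Polynomial.funext fun x => by simpa using h x)
  refine ⟨c, ?_⟩
  rw [length_coker_xSubEnd c 0 IsNilpotent.zero, Module.length_eq_zero_iff.2, zero_add]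
  rw [Submodule.Quotient.subsingleton_iff, LinearMap.range_eq_top]
  intro t
  obtain ⟨s, hs⟩ := Polynomial.X_sub_C_dvd_sub_C_eval (p := q) (a := c)
  have ht : q • t = 0 := Submodule.mem_annihilator.1 hq t trivial
  -- From `q = (X - c) s + q(c)` and `q t = 0` one gets `(X - c) s t = -q(c) t`, which is solved for
  -- `t`.
  refine ⟨(-Polynomial.C (q.eval c)⁻¹ * s) • t, ?_⟩
  rw [LinearMap.restrictScalars_apply, xSubEnd_apply]
  have hz : torsionRestrict (0 : Module.End K[X] C) = 0 := by
    ext x; simp [torsionRestrict]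
  rw [hz, LinearMap.zero_apply, sub_zero, smul_smul, mul_left_comm, ← hs, mul_smul, sub_smul, ht,
    zero_sub, neg_smul, smul_neg, neg_neg, smul_smul, ← Polynomial.C_mul, inv_mul_cancel₀ hc,
    Polynomial.C_1, one_smul]

end Cokernel

/-! ### Ranks of powers of operators in a pencil -/

section Pencil

variable {K : Type*} [Field K] {V : Type*} [AddCommGroup V] [Module K V]

/-- The evaluation `p ⊗ v ↦ p(e) v`. -/
def evalEnd (e : Module.End K V) : K[X] ⊗[K] V →ₗ[K] V :=
  TensorProduct.lift (Polynomial.aeval e).toLinearMap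

theorem evalEnd_tmul (e : Module.End K V) (p : K[X]) (v : V) :
    evalEnd e (p ⊗ₜ v) = Polynomial.aeval e p v := by
  simp [evalEnd]

theorem evalEnd_X_smul (e : Module.End K V) (x : K[X] ⊗[K] V) :
    evalEnd e ((Polynomial.X : K[X]) • x) = e (evalEnd e x) := by
  induction x with
  | zero => simp
  | tmul p v => simp [TensorProduct.smul_tmul', evalEnd_tmul]
  | add x y hx hy => rw [smul_add, map_add, hx, hy, map_add, map_add]

theorem evalEnd_baseChange (e f : Module.End K V) (h : Commute e f) (x : K[X] ⊗[K] V) :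
    evalEnd e (f.baseChange K[X] x) = f (evalEnd e x) := by
  induction x with
  | zero => simp
  | tmul p v =>
    have h1 : Commute (Polynomial.aeval e p) f := by
      rw [Polynomial.aeval_eq_sum_range]
      exact Commute.sum_left _ _ _ fun i _ => (h.pow_left i).smul_left _
    rw [LinearMap.baseChange_tmul, evalEnd_tmul, evalEnd_tmul, ← Module.End.mul_apply, h1.eq,
      Module.End.mul_apply]
  | add x y hx hy => rw [map_add, map_add, hx, hy, map_add, map_add]

theorem evalEnd_surjective (e : Module.End K V) : Function.Surjective (evalEnd e) := fun v =>
  ⟨1 ⊗ₜ v, by simp [evalEnd_tmul]⟩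

theorem evalEnd_xSubEnd (c : K) (γ : Module.End K V) (x : K[X] ⊗[K] V) :
    evalEnd (algebraMap K _ c + γ) (xSubEnd c (γ.baseChange K[X]) x) = 0 := by
  have h : Commute (algebraMap K (Module.End K V) c + γ) γ :=
    Commute.add_left (Algebra.commutes c γ) (Commute.refl γ)
  rw [xSubEnd_apply, sub_smul, map_sub, map_sub, evalEnd_X_smul, evalEnd_baseChange _ _ h]
  have : (Polynomial.C c : K[X]) • x = c • x := by
    rw [← algebraMap_smul K[X] c x]; rfl
  rw [this, map_smul]
  simp

/-- This is the presentation of `V`, with `X` acting as `e = c + γ`, as the cokernel of `X - e` on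
`K[X] ⊗ V`: modulo the image, `X ^ n ⊗ v` equals `1 ⊗ e ^ n v`, so every element is congruent to `1
⊗` its evaluation. -/
theorem ker_evalEnd (c : K) (γ : Module.End K V) :
    LinearMap.ker (evalEnd (algebraMap K _ c + γ)) =
      LinearMap.range ((xSubEnd c (γ.baseChange K[X])).restrictScalars K) := by
  set e := algebraMap K (Module.End K V) c + γ with he
  set N := LinearMap.range ((xSubEnd c (γ.baseChange K[X])).restrictScalars K) with hN
  refine le_antisymm (fun x hx => ?_) ?_
  · have key : ∀ y : K[X] ⊗[K] V, N.mkQ y = N.mkQ (1 ⊗ₜ evalEnd e y) := by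
      have hstep : ∀ (n : ℕ) (v : V), N.mkQ ((Polynomial.X ^ n : K[X]) ⊗ₜ v) =
          N.mkQ ((1 : K[X]) ⊗ₜ[K] (e ^ n) v) := by
        intro n
        induction n with
        | zero => simp
        | succ n ih =>
          intro v
          rw [pow_succ e, Module.End.mul_apply, ← ih]
          refine (Submodule.Quotient.eq N).2 ⟨(Polynomial.X ^ n : K[X]) ⊗ₜ v, ?_⟩
          rw [LinearMap.restrictScalars_apply, xSubEnd_apply, sub_smul, he, LinearMap.add_apply,
            TensorProduct.tmul_add, LinearMap.baseChange_tmul, TensorProduct.smul_tmul',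
            TensorProduct.smul_tmul', Module.algebraMap_end_apply, TensorProduct.tmul_smul,
            TensorProduct.smul_tmul', smul_eq_mul, smul_eq_mul, pow_succ', ← Polynomial.C_mul',
            sub_sub]
      have : N.mkQ = N.mkQ ∘ₗ (TensorProduct.mk K K[X] V 1) ∘ₗ evalEnd e := by
        refine TensorProduct.ext (Polynomial.lhom_ext' fun n =>
          LinearMap.ext_ring (LinearMap.ext fun v => ?_))
        change N.mkQ (Polynomial.monomial n 1 ⊗ₜ v) =
          N.mkQ (1 ⊗ₜ evalEnd e (Polynomial.monomial n 1 ⊗ₜ v))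
        rw [Polynomial.monomial_one_right_eq_X_pow, evalEnd_tmul, map_pow, Polynomial.aeval_X]
        exact hstep n v
      exact fun y => congrArg (fun f => f y) this
    have := key x
    rw [LinearMap.mem_ker.1 hx, TensorProduct.tmul_zero, map_zero] at this
    exact (Submodule.Quotient.mk_eq_zero N).1 this
  · rintro _ ⟨x, rfl⟩
    exact evalEnd_xSubEnd c γ x

/-- The cokernel of an operator on `V` as a quotient of the cokernel of a `K[X]`-linear operator
on `K[X] ⊗ V` which specialises to it. -/
theorem length_coker_specialize (c : K) (γ B : Module.End K V)
    (A : Module.End K[X] (K[X] ⊗[K] V))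
    (hAB : ∀ x, evalEnd (algebraMap K _ c + γ) (A x) = B (evalEnd (algebraMap K _ c + γ) x))
    (θ : Module.End K[X] ((K[X] ⊗[K] V) ⧸ LinearMap.range A))
    (hθ : ∀ x, θ (Submodule.Quotient.mk x) = Submodule.Quotient.mk (γ.baseChange K[X] x)) :
    Module.length K (((K[X] ⊗[K] V) ⧸ LinearMap.range A) ⧸
      LinearMap.range ((xSubEnd c θ).restrictScalars K)) =
    Module.length K (V ⧸ LinearMap.range B) := by
  let ev := evalEnd (algebraMap K _ c + γ)
  let π : ((K[X] ⊗[K] V) ⧸ LinearMap.range A) →ₗ[K] V ⧸ LinearMap.range B :=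
    Submodule.liftQ ((LinearMap.range A).restrictScalars K)
      ((LinearMap.range B).mkQ ∘ₗ ev) (by
        rintro _ ⟨x, rfl⟩
        exact (Submodule.Quotient.mk_eq_zero _).2 ⟨ev x, (hAB x).symm⟩) ∘ₗ
      (Submodule.Quotient.restrictScalarsEquiv K (LinearMap.range A)).symm.toLinearMap
  have hπ : ∀ x, π (Submodule.Quotient.mk x) = Submodule.Quotient.mk (ev x) := fun _ => rfl
  have hs : Function.Surjective π := by
    intro y
    obtain ⟨v, rfl⟩ := Submodule.mkQ_surjective _ y
    obtain ⟨x, rfl⟩ := evalEnd_surjective (algebraMap K _ c + γ) v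
    exact ⟨Submodule.Quotient.mk x, hπ x⟩
  have hx : ∀ x, xSubEnd c θ (Submodule.Quotient.mk x) =
      Submodule.Quotient.mk (xSubEnd c (γ.baseChange K[X]) x) := by
    intro x
    rw [xSubEnd_apply, hθ, xSubEnd_apply]
    rfl
  have hk : LinearMap.ker π = LinearMap.range ((xSubEnd c θ).restrictScalars K) := by
    ext y
    obtain ⟨x, rfl⟩ := Submodule.mkQ_surjective _ y
    constructor
    · intro h
      obtain ⟨w, hw⟩ := (Submodule.Quotient.mk_eq_zero _).1 ((hπ x).symm.trans h)
      obtain ⟨z, rfl⟩ := evalEnd_surjective (algebraMap K _ c + γ) w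
      have h1 : x - A z ∈ LinearMap.ker ev := by
        rw [LinearMap.mem_ker, map_sub, sub_eq_zero, ← hw]
        exact (hAB z).symm
      rw [ker_evalEnd] at h1
      obtain ⟨t, ht⟩ := h1
      refine ⟨Submodule.Quotient.mk t, ?_⟩
      rw [LinearMap.restrictScalars_apply, hx]
      refine (Submodule.Quotient.eq _).2 ⟨-z, ?_⟩
      rw [LinearMap.restrictScalars_apply] at ht
      rw [ht, map_neg]
      simp
    · rintro ⟨t, ht⟩
      obtain ⟨s, rfl⟩ := Submodule.mkQ_surjective _ t
      rw [LinearMap.mem_ker, ← ht]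
      refine (congrArg π (hx s)).trans ((hπ _).trans ?_)
      exact (congrArg _ (evalEnd_xSubEnd c γ s)).trans (Submodule.Quotient.mk_zero _)
  rw [← hk]
  exact LinearEquiv.length_eq (π.quotKerEquivOfSurjective hs)

variable [FiniteDimensional K V]

theorem finrank_coker_add_jRank (j : ℕ) (f : Module.End K V) :
    Module.finrank K (V ⧸ LinearMap.range (f ^ j)) + jRank j f = Module.finrank K V :=
  Submodule.finrank_quotient_add_finrank _

/-- The cokernels of the operators `(α + (c + γ) β) ^ j` are controlled by one `K[X]`-module. -/
theorem exists_corank_pencil [Infinite K] (α β γ : Module.End K V) (hαγ : Commute α γ)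
    (hβγ : Commute β γ) (hγ : IsNilpotent γ) (j : ℕ) :
    ∃ d : ℕ, (∀ c : K, d ≤ Module.finrank K (V ⧸ LinearMap.range ((α + c • β) ^ j))) ∧
      (∃ c : K, d = Module.finrank K (V ⧸ LinearMap.range ((α + c • β) ^ j))) ∧
      d ≤ Module.finrank K (V ⧸ LinearMap.range ((α + γ * β) ^ j)) ∧
      (d = Module.finrank K (V ⧸ LinearMap.range (α ^ j)) →
        d = Module.finrank K (V ⧸ LinearMap.range ((α + γ * β) ^ j))) := by
  let A₁ : Module.End K[X] (K[X] ⊗[K] V) :=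
    α.baseChange K[X] + (Polynomial.X : K[X]) • β.baseChange K[X]
  let A := A₁ ^ j
  have hA₁ : ∀ e : Module.End K V, Commute e α → Commute e β → ∀ x,
      evalEnd e (A₁ x) = (α + e * β) (evalEnd e x) := by
    intro e h1 h2 x
    simp only [A₁, LinearMap.add_apply, map_add, LinearMap.smul_apply, evalEnd_X_smul,
      evalEnd_baseChange _ _ h1, evalEnd_baseChange _ _ h2, Module.End.mul_apply]
  have hA : ∀ e : Module.End K V, Commute e α → Commute e β → ∀ x,
      evalEnd e (A x) = ((α + e * β) ^ j) (evalEnd e x) := by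
    intro e h1 h2
    simp only [A]
    generalize j = n
    induction n with
    | zero => simp
    | succ n ih => intro x; rw [pow_succ, Module.End.mul_apply, ih, hA₁ e h1 h2, pow_succ,
        Module.End.mul_apply]
  have hcomm : Commute A (γ.baseChange K[X]) := by
    refine Commute.pow_left ?_ j
    have hb : ∀ f : Module.End K V, Commute f γ →
        Commute (f.baseChange K[X]) (γ.baseChange K[X]) := by
      intro f hf
      rw [commute_iff_eq, Module.End.mul_eq_comp, Module.End.mul_eq_comp,
        ← LinearMap.baseChange_comp, ← LinearMap.baseChange_comp]
      exact congrArg _ hf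
    exact (hb α hαγ).add_left ((hb β hβγ).smul_left _)
  let θ : Module.End K[X] ((K[X] ⊗[K] V) ⧸ LinearMap.range A) :=
    Submodule.mapQ _ _ (γ.baseChange K[X]) (by
      rintro _ ⟨x, rfl⟩
      exact ⟨γ.baseChange K[X] x, congrArg (fun f => f x) hcomm.eq⟩)
  have hθ : IsNilpotent θ := by
    obtain ⟨n, hn⟩ := hγ
    have hp : ∀ (m : ℕ) (x : K[X] ⊗[K] V), (θ ^ m) (Submodule.Quotient.mk x) =
        Submodule.Quotient.mk (((γ ^ m).baseChange K[X]) x) := by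
      intro m
      induction m with
      | zero => intro x; simp
      | succ m ih =>
        intro x
        rw [pow_succ, Module.End.mul_apply, pow_succ, Module.End.mul_eq_comp,
          LinearMap.baseChange_comp, LinearMap.comp_apply, ← ih]
        rfl
    refine ⟨n, LinearMap.ext fun y => ?_⟩
    obtain ⟨x, rfl⟩ := Submodule.mkQ_surjective _ y
    exact (hp n x).trans (by rw [hn]; simp)
  -- `h0` specialises `X` to the scalar `c`, and `h1` below specialises `X` to `γ`; both are read
  -- off from the same cokernel of `A`.
  have h0 : ∀ c : K, Module.length K (((K[X] ⊗[K] V) ⧸ LinearMap.range A) ⧸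
      LinearMap.range ((xSubEnd c (0 : Module.End K[X] ((K[X] ⊗[K] V) ⧸ LinearMap.range A))
        ).restrictScalars K)) =
      Module.finrank K (V ⧸ LinearMap.range ((α + c • β) ^ j)) := by
    intro c
    rw [← Module.length_eq_finrank]
    refine length_coker_specialize c 0 _ A ?_ 0 (fun x => by simp)
    intro x
    have := hA (algebraMap K _ c + 0) (by rw [add_zero]; exact Algebra.commutes c α)
      (by rw [add_zero]; exact Algebra.commutes c β) x
    rwa [show α + (algebraMap K (Module.End K V) c + 0) * β = α + c • β by
      rw [add_zero, Algebra.smul_def]] at this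
  have h1 : Module.length K (((K[X] ⊗[K] V) ⧸ LinearMap.range A) ⧸
      LinearMap.range ((xSubEnd 0 θ).restrictScalars K)) =
      Module.finrank K (V ⧸ LinearMap.range ((α + γ * β) ^ j)) := by
    rw [← Module.length_eq_finrank]
    refine length_coker_specialize 0 γ _ A ?_ θ (fun x => rfl)
    rw [map_zero, zero_add]
    exact hA γ hαγ.symm hβγ.symm
  -- The generic corank `d` is the rank of the cokernel of `A` modulo torsion.
  refine ⟨Module.finrank K[X] (((K[X] ⊗[K] V) ⧸ LinearMap.range A) ⧸
    Submodule.torsion K[X] ((K[X] ⊗[K] V) ⧸ LinearMap.range A)), fun c => ?_, ?_, ?_, fun h => ?_⟩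
  · have := h0 c
    rw [length_coker_xSubEnd c 0 IsNilpotent.zero] at this
    exact_mod_cast le_of_le_of_eq le_add_self this
  · obtain ⟨c, hc⟩ := exists_length_coker_X_sub_C_eq
      (K := K) (C := (K[X] ⊗[K] V) ⧸ LinearMap.range A)
    exact ⟨c, by exact_mod_cast hc.symm.trans (h0 c)⟩
  · have := h1
    rw [length_coker_xSubEnd 0 θ hθ] at this
    exact_mod_cast le_of_le_of_eq le_add_self this
  · have h2 := h0 0
    rw [zero_smul, add_zero, ← h] at h2
    exact_mod_cast (length_coker_xSubEnd_of_eq 0 θ hθ h2).symm.trans h1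

/-- An operator of the form `α + γ β` with `γ` nilpotent has at most the `j`-rank of some operator
in the pencil `α + c β`. -/
theorem exists_jRank_add_mul_le [Infinite K] (α β γ : Module.End K V) (hαγ : Commute α γ)
    (hβγ : Commute β γ) (hγ : IsNilpotent γ) (j : ℕ) :
    ∃ c : K, jRank j (α + γ * β) ≤ jRank j (α + c • β) := by
  obtain ⟨d, -, ⟨c, hc⟩, h, -⟩ := exists_corank_pencil α β γ hαγ hβγ hγ j
  refine ⟨c, ?_⟩
  have h1 := finrank_coker_add_jRank j (α + γ * β)
  have h2 := finrank_coker_add_jRank j (α + c • β)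
  omega

/-- If `α` has maximal `j`-rank in the pencil `α + c β`, then `α + γ β` has the same `j`-rank for
nilpotent `γ`. -/
theorem jRank_add_mul_eq [Infinite K] (α β γ : Module.End K V) (hαγ : Commute α γ)
    (hβγ : Commute β γ) (hγ : IsNilpotent γ) (j : ℕ)
    (hmax : ∀ c : K, jRank j (α + c • β) ≤ jRank j α) : jRank j (α + γ * β) = jRank j α := by
  obtain ⟨d, h1, ⟨c, hc⟩, -, h⟩ := exists_corank_pencil α β γ hαγ hβγ hγ j
  have h2 := finrank_coker_add_jRank j (α + γ * β)
  have h3 := finrank_coker_add_jRank j (α + c • β)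
  have h4 := finrank_coker_add_jRank j α
  have h5 := hmax c
  have h6 := h1 0
  rw [zero_smul, add_zero] at h6
  have := h (by omega)
  omega

end Pencil

/-! ### Adding several commuting nilpotent multiples -/

section Perturbation

variable {K : Type*} [Field K] [Infinite K] {V : Type*} [AddCommGroup V] [Module K V]
  [FiniteDimensional K V]

/-- Adding products `g i * U i` with nilpotent `g i` to a linear combination of commuting operators
`U i` neither exceeds the maximal `j`-rank of the linear combinations nor affects whether it is
attained. -/
theorem jRank_perturb {ι : Type*} [DecidableEq ι] (s : Finset ι) (U g : ι → Module.End K V)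
    (hUg : ∀ i l, Commute (U i) (g l))
    (hgg : ∀ i l, Commute (g i) (g l)) (hg : ∀ i, IsNilpotent (g i)) (j R : ℕ)
    (hR : ∀ c : ι → K, jRank j (∑ i ∈ s, c i • U i) ≤ R) (t : Finset ι) (hts : t ⊆ s) :
    ∀ c : ι → K, jRank j (∑ i ∈ s, c i • U i + ∑ i ∈ t, g i * U i) ≤ R ∧
      (jRank j (∑ i ∈ s, c i • U i + ∑ i ∈ t, g i * U i) = R ↔
        jRank j (∑ i ∈ s, c i • U i) = R) := by
  induction t using Finset.induction_on with
  | empty => intro c; simpa using hR c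
  | insert m t hm ih =>
    have ih := ih ((Finset.subset_insert m t).trans hts)
    have hms : m ∈ s := hts (Finset.mem_insert_self m t)
    -- Moving along the pencil in direction `U m` only changes the coefficient of `U m`, so the
    -- induction hypothesis, stated for all `c`, covers every member.
    have hupd : ∀ (c : ι → K) (x : K), ∑ i ∈ s, c i • U i + x • U m =
        ∑ i ∈ s, (c + Pi.single m x : ι → K) i • U i := by
      intro c x
      simp only [Pi.add_apply, add_smul, Finset.sum_add_distrib, Pi.single_apply, ite_smul,
        zero_smul, Finset.sum_ite_eq', hms, if_true]
    have hc : ∀ c : ι → K, Commute (∑ i ∈ s, c i • U i + ∑ i ∈ t, g i * U i) (g m) := fun c =>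
      (Commute.sum_left _ _ _ fun i _ => (hUg i m).smul_left _).add_left
        (Commute.sum_left _ _ _ fun i _ => (hgg i m).mul_left (hUg i m))
    have hpencil : ∀ (c : ι → K) (x : K),
        ∑ i ∈ s, c i • U i + ∑ i ∈ t, g i * U i + x • U m =
        ∑ i ∈ s, (c + Pi.single m x : ι → K) i • U i + ∑ i ∈ t, g i * U i := by
      intro c x
      rw [← hupd, add_right_comm]
    have hle : ∀ c : ι → K,
        jRank j (∑ i ∈ s, c i • U i + ∑ i ∈ t, g i * U i + g m * U m) ≤ R := by
      intro c
      obtain ⟨x, hx⟩ := exists_jRank_add_mul_le _ (U m) (g m) (hc c) (hUg m m) (hg m) j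
      rw [hpencil] at hx
      exact hx.trans (ih _).1
    intro c
    rw [Finset.sum_insert hm, add_comm (g m * U m), ← add_assoc]
    refine ⟨hle c, ?_⟩
    rw [← (ih c).2]
    constructor
    · intro h
      -- The perturbation is removed by adding `-g m * U m`. The perturbed operator is maximal in
      -- its pencil because it attains `R` and `hle` bounds all the others.
      have h1 := jRank_add_mul_eq (∑ i ∈ s, c i • U i + ∑ i ∈ t, g i * U i + g m * U m) (U m)
        (-g m) (((hc c).add_left ((Commute.refl (g m)).mul_left (hUg m m))).neg_right)
        (hUg m m).neg_right (hg m).neg j (fun x => by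
          rw [h, add_right_comm, hpencil]
          exact hle _)
      rw [neg_mul, add_neg_cancel_right] at h1
      rw [h1, h]
    · intro h
      rw [jRank_add_mul_eq _ (U m) (g m) (hc c) (hUg m m) (hg m) j, h]
      intro x
      rw [h, hpencil]
      exact (ih _).1

end Perturbation

/-! ### Binomial coefficients modulo a prime -/

/-- The exponent found is the `p`-adic valuation of `n`: by Lucas, dividing both entries by `p` does
not change the binomial coefficient modulo `p`, and once `p ∤ n`, the choice `n.choose 1 = n` works.
-/
theorem exists_not_dvd_choose_prime_pow {p : ℕ} [Fact p.Prime] (n : ℕ) (hn : 0 < n) :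
    ∃ i, p ^ i ≤ n ∧ ¬ p ∣ n.choose (p ^ i) := by
  have hp := (Fact.out : p.Prime)
  induction n using Nat.strong_induction_on with
  | _ n ih =>
    by_cases h : p ∣ n
    · obtain ⟨m, rfl⟩ := h
      have hm : 0 < m := Nat.pos_of_mul_pos_left hn
      obtain ⟨i, hi, hd⟩ := ih m (lt_mul_of_one_lt_left hm hp.one_lt) hm
      refine ⟨i + 1, by rw [pow_succ']; exact Nat.mul_le_mul_left p hi, ?_⟩
      have h1 := Choose.choose_modEq_choose_mod_mul_choose_div_nat (p := p) (n := p * m)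
        (k := p ^ (i + 1))
      rw [pow_succ', Nat.mul_mod_right, Nat.mul_mod_right, Nat.choose_self, one_mul,
        Nat.mul_div_cancel_left _ hp.pos, Nat.mul_div_cancel_left _ hp.pos] at h1
      rw [pow_succ']
      exact fun hdvd => hd ((h1.dvd_iff dvd_rfl).1 hdvd)
    · exact ⟨0, by rw [pow_zero]; exact hn, by simpa using h⟩

theorem exists_not_dvd_choose_of_ne_pow {p : ℕ} [Fact p.Prime] (n : ℕ) (hn : 0 < n)
    (hne : ∀ i, n ≠ p ^ i) : ∃ i, p ^ i < n ∧ ¬ p ∣ n.choose (p ^ i) := by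
  obtain ⟨i, hi, hd⟩ := exists_not_dvd_choose_prime_pow (p := p) n hn
  exact ⟨i, lt_of_le_of_ne hi (hne i).symm, hd⟩

/-! ### Systems of divided powers -/

/-- Operators which multiply as the divided powers `t ^ n / n!` do, vanishing for `n ≥ N`. -/
structure IsDividedPowers {K : Type*} [Field K] {V : Type*} [AddCommGroup V] [Module K V]
    (N : ℕ) (D : ℕ → Module.End K V) : Prop where
  zero : D 0 = 1
  mul : ∀ a b, D a * D b = ((a + b).choose a : K) • D (a + b)
  eq_zero : ∀ n, N ≤ n → D n = 0

namespace IsDividedPowers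

variable {K : Type*} [Field K] {V : Type*} [AddCommGroup V] [Module K V] {N : ℕ}
  {D : ℕ → Module.End K V} (hD : IsDividedPowers N D)

include hD

theorem commute (a b : ℕ) : Commute (D a) (D b) := by
  rw [commute_iff_eq, hD.mul, hD.mul, add_comm b a, Nat.choose_symm_add]

theorem pow (a n : ℕ) : ∃ c : K, D a ^ n = c • D (n * a) := by
  induction n with
  | zero => exact ⟨1, by simp [hD.zero]⟩
  | succ n ih =>
    obtain ⟨c, hc⟩ := ih
    refine ⟨c * ((n * a + a).choose (n * a) : K), ?_⟩
    rw [pow_succ, hc, smul_mul_assoc, hD.mul, smul_smul, add_mul, one_mul]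

theorem isNilpotent (a : ℕ) (ha : 0 < a) : IsNilpotent (D a) := by
  obtain ⟨c, hc⟩ := hD.pow a N
  exact ⟨N, by rw [hc, hD.eq_zero _ (Nat.le_mul_of_pos_right N ha), smul_zero]⟩

variable (p : ℕ) [Fact p.Prime] [CharP K p]

/-- The power is a multiple of `D ((p - 1) p ^ i) * D (p ^ i)`, hence of `(p ^ (i + 1)).choose (p ^
i)`, which is divisible by `p`. -/
theorem pow_prime_pow_eq_zero (i : ℕ) : D (p ^ i) ^ p = 0 := by
  have hp := (Fact.out : p.Prime)
  obtain ⟨c, hc⟩ := hD.pow (p ^ i) (p - 1)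
  obtain ⟨q, hq⟩ : ∃ q, p = q + 1 := ⟨p - 1, (Nat.sub_add_cancel hp.one_le).symm⟩
  have h1 : (p - 1) * p ^ i + p ^ i = p ^ (i + 1) := by
    rw [pow_succ', Nat.sub_one_mul]
    exact Nat.sub_add_cancel (Nat.le_mul_of_pos_left _ hp.pos)
  have h2 : ((p ^ (i + 1)).choose (p ^ i) : K) = 0 := by
    rw [CharP.cast_eq_zero_iff K p]
    exact hp.dvd_choose_pow (pow_pos hp.pos i).ne'
      (Nat.pow_lt_pow_right hp.one_lt (Nat.lt_succ_self i)).ne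
  have h3 : D (p ^ i) ^ p = D (p ^ i) ^ (p - 1) * D (p ^ i) := by
    rw [← pow_succ, Nat.sub_add_cancel hp.one_le]
  rw [h3, hc, smul_mul_assoc, hD.mul, h1, ← h1, Nat.choose_symm_add, h1, h2, zero_smul, smul_zero]

theorem sum_pow_prime_eq_zero (s : Finset ℕ) (c : ℕ → K) :
    (∑ i ∈ s, c i • D (p ^ i)) ^ p = 0 := by
  rcases subsingleton_or_nontrivial V with h | h
  · exact Subsingleton.elim _ _
  have : CharP (Module.End K V) p :=
    charP_of_injective_algebraMap (algebraMap K (Module.End K V)).injective p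
  induction s using Finset.induction_on with
  | empty => simp [(Fact.out : p.Prime).ne_zero]
  | insert i s hi ih =>
    rw [Finset.sum_insert hi, add_pow_char_of_commute p, ih, add_zero, smul_pow,
      hD.pow_prime_pow_eq_zero, smul_zero]
    exact Commute.sum_right _ _ _ fun l _ => ((hD.commute _ _).smul_left _).smul_right _

-- The index set on the left is `0` together with the powers of `p` below `N`. Letting `i` run over
-- all of `range N` is harmless: `p ^ i < N` forces `i < N`, and the surplus terms have `D (p ^ i) =
-- 0`.
omit [CharP K p] in
open Classical in
theorem sum_filter_pow (φ : ℕ → K) (hφ : φ 0 = 0) :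
    ∑ n ∈ Finset.range N with ¬(0 < n ∧ ∀ i, n ≠ p ^ i), φ n • D n =
      ∑ i ∈ Finset.range N, φ (p ^ i) • D (p ^ i) := by
  have hp := (Fact.out : p.Prime)
  have hsub : ((Finset.range N).filter fun i => p ^ i < N).image (fun i => p ^ i) ⊆
      (Finset.range N).filter fun n => ¬(0 < n ∧ ∀ i, n ≠ p ^ i) := by
    intro n hn
    obtain ⟨i, hi, rfl⟩ := Finset.mem_image.1 hn
    exact Finset.mem_filter.2 ⟨Finset.mem_range.2 (Finset.mem_filter.1 hi).2,
      fun h => h.2 i rfl⟩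
  rw [← Finset.sum_subset hsub, Finset.sum_image
    (Nat.pow_right_injective hp.two_le).injOn, Finset.sum_filter]
  · refine Finset.sum_congr rfl fun i _ => ?_
    split_ifs with h1
    · rfl
    · rw [hD.eq_zero _ (not_lt.1 h1), smul_zero]
  · intro n hn hn'
    obtain ⟨h1, h2⟩ := Finset.mem_filter.1 hn
    rcases Nat.eq_zero_or_pos n with rfl | h0
    · rw [hφ, zero_smul]
    · push Not at h2
      obtain ⟨i, rfl⟩ := h2 h0
      refine absurd ?_ hn'
      refine Finset.mem_image_of_mem _ (Finset.mem_filter.2 ⟨?_, Finset.mem_range.1 h1⟩)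
      exact Finset.mem_range.2 ((Nat.lt_pow_self hp.one_lt).trans (Finset.mem_range.1 h1))

/-- A combination of divided powers is a linear combination of the `D (p ^ i)` plus products of
these with nilpotent operators. -/
theorem exists_decomposition (φ : ℕ → K) (hφ : φ 0 = 0) :
    ∃ g : ℕ → Module.End K V, (∀ i l, Commute (D (p ^ i)) (g l)) ∧ (∀ i l, Commute (g i) (g l)) ∧
      (∀ i, IsNilpotent (g i)) ∧ ∑ n ∈ Finset.range N, φ n • D n =
        ∑ i ∈ Finset.range N, φ (p ^ i) • D (p ^ i) + ∑ i ∈ Finset.range N, g i * D (p ^ i) := by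
  classical
  have hp := (Fact.out : p.Prime)
  have hex : ∀ n, ∃ i, (0 < n ∧ ∀ i, n ≠ p ^ i) → p ^ i < n ∧ ¬ p ∣ n.choose (p ^ i) := by
    intro n
    by_cases h : 0 < n ∧ ∀ i, n ≠ p ^ i
    · obtain ⟨i, hi⟩ := exists_not_dvd_choose_of_ne_pow n h.1 h.2
      exact ⟨i, fun _ => hi⟩
    · exact ⟨0, fun h' => absurd h' h⟩
  choose ix hix using hex
  let S := (Finset.range N).filter fun n => 0 < n ∧ ∀ i, n ≠ p ^ i
  -- From `D (n - p ^ i) * D (p ^ i) = n.choose (p ^ i) • D n` with an invertible binomial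
  -- coefficient; the factor `D (n - p ^ i)` is nilpotent because `p ^ i < n`.
  let h : ℕ → Module.End K V := fun n =>
    (φ n * ((n.choose (p ^ ix n) : K))⁻¹) • D (n - p ^ ix n)
  have hS : ∀ n ∈ S, p ^ ix n < n ∧ ¬ p ∣ n.choose (p ^ ix n) := fun n hn =>
    hix n (Finset.mem_filter.1 hn).2
  have hmul : ∀ n ∈ S, φ n • D n = h n * D (p ^ ix n) := by
    intro n hn
    obtain ⟨h1, h2⟩ := hS n hn
    have h3 : ((n.choose (p ^ ix n) : ℕ) : K) ≠ 0 := fun h0 =>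
      h2 ((CharP.cast_eq_zero_iff K p _).1 h0)
    simp only [h]
    rw [smul_mul_assoc, hD.mul, Nat.choose_symm_add, Nat.sub_add_cancel h1.le, smul_smul,
      mul_assoc, inv_mul_cancel₀ h3, mul_one]
  have hcomm : ∀ n l, Commute (h n) (h l) := fun n l =>
    ((hD.commute _ _).smul_left _).smul_right _
  refine ⟨fun i => ∑ n ∈ S with ix n = i, h n, ?_, ?_, ?_, ?_⟩
  · exact fun i l => Commute.sum_right _ _ _ fun n _ => (hD.commute _ _).smul_right _
  · exact fun i l => Commute.sum_right _ _ _ fun n _ => Commute.sum_left _ _ _ fun m _ => hcomm m n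
  · refine fun i => Commute.isNilpotent_sum (fun n hn => ?_) fun n m _ _ => hcomm n m
    exact (hD.isNilpotent _ (Nat.sub_pos_of_lt (hS n (Finset.mem_filter.1 hn).1).1)).smul _
  · rw [← Finset.sum_filter_add_sum_filter_not (Finset.range N) (fun n => 0 < n ∧ ∀ i, n ≠ p ^ i),
      hD.sum_filter_pow p φ hφ, add_comm]
    refine congrArg _ ((Finset.sum_congr rfl hmul).trans ?_)
    have hmaps : ∀ n ∈ S, ix n ∈ Finset.range N := fun n hn =>
      Finset.mem_range.2 (((Nat.lt_pow_self hp.one_lt).trans (hS n hn).1).trans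
        (Finset.mem_range.1 (Finset.mem_filter.1 hn).1))
    rw [← Finset.sum_fiberwise_of_maps_to hmaps]
    refine Finset.sum_congr rfl fun i _ => ?_
    rw [Finset.sum_mul]
    refine Finset.sum_congr rfl fun n hn => ?_
    rw [(Finset.mem_filter.1 hn).2]

/-- A combination of divided powers and its linear part, with respect to a bound `R` for the
`j`-ranks of all linear parts. -/
theorem jRank_le_and_eq_iff [Infinite K] [FiniteDimensional K V] (φ : ℕ → K) (hφ : φ 0 = 0)
    (j R : ℕ) (hR : ∀ c : ℕ → K, jRank j (∑ i ∈ Finset.range N, c i • D (p ^ i)) ≤ R) :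
    jRank j (∑ n ∈ Finset.range N, φ n • D n) ≤ R ∧
      (jRank j (∑ n ∈ Finset.range N, φ n • D n) = R ↔
        jRank j (∑ i ∈ Finset.range N, φ (p ^ i) • D (p ^ i)) = R) := by
  obtain ⟨g, h1, h2, h3, h4⟩ := hD.exists_decomposition p φ hφ
  rw [h4]
  exact jRank_perturb (Finset.range N) (fun i => D (p ^ i)) g h1 h2 h3
    j R hR _ subset_rfl fun i => φ (p ^ i)

end IsDividedPowers

/-! ### Coefficient operators of a comodule and their divided power relations -/

namespace RationalGaModule

variable {K : Type u} [Field K] {M : Type v} [AddCommGroup M] [Module K M]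

/-- The coefficient of `T ^ n` in the coaction. -/
def coeffOp (ρ : RationalGaModule K M) (n : ℕ) : Module.End K M :=
  ρ.act (Polynomial.lcoeff K n)

theorem act_apply (ρ : RationalGaModule K M) (φ : K[X] →ₗ[K] K) (m : M) :
    ρ.act φ m = TensorProduct.rid K M (φ.lTensor M (ρ.coaction m)) := rfl

theorem act_add (ρ : RationalGaModule K M) (φ ψ : K[X] →ₗ[K] K) :
    ρ.act (φ + ψ) = ρ.act φ + ρ.act ψ := by
  ext m
  simp [act_apply, LinearMap.lTensor_add]

theorem act_smul (ρ : RationalGaModule K M) (c : K) (φ : K[X] →ₗ[K] K) :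
    ρ.act (c • φ) = c • ρ.act φ := by
  ext m
  simp [act_apply, LinearMap.lTensor_smul]

theorem act_sum (ρ : RationalGaModule K M) {ι : Type*} (s : Finset ι) (φ : ι → K[X] →ₗ[K] K) :
    ρ.act (∑ i ∈ s, φ i) = ∑ i ∈ s, ρ.act (φ i) := by
  classical
  induction s using Finset.induction_on with
  | empty =>
    ext m
    simp [act_apply]
  | insert i s hi ih => rw [Finset.sum_insert hi, Finset.sum_insert hi, act_add, ih]

theorem eq_sum_of_mem_range_lTensor_degreeLT (N : ℕ) (y : M ⊗[K] K[X])
    (hy : y ∈ LinearMap.range ((Polynomial.degreeLT K N).subtype.lTensor M)) :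
    y = ∑ n ∈ Finset.range N,
      TensorProduct.rid K M ((Polynomial.lcoeff K n).lTensor M y) ⊗ₜ[K]
        (Polynomial.X ^ n : K[X]) := by
  obtain ⟨z, rfl⟩ := hy
  induction z with
  | zero => simp
  | tmul m q =>
    have hq : (q : K[X]) = ∑ n ∈ Finset.range N, (q : K[X]).coeff n • Polynomial.X ^ n := by
      have h := Polynomial.mem_degreeLT.1 q.2
      ext l
      simp only [Polynomial.finsetSum_coeff, Polynomial.coeff_smul, Polynomial.coeff_X_pow,
        smul_eq_mul, mul_ite, mul_one, mul_zero, Finset.sum_ite_eq, Finset.mem_range]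
      split_ifs with hl
      · rfl
      · exact Polynomial.coeff_eq_zero_of_degree_lt (h.trans_le (by exact_mod_cast not_lt.1 hl))
    simp only [LinearMap.lTensor_tmul, Submodule.subtype_apply, Polynomial.lcoeff_apply,
      TensorProduct.rid_tmul]
    conv_lhs => rw [hq]
    rw [TensorProduct.tmul_sum]
    exact Finset.sum_congr rfl fun n _ => by rw [TensorProduct.tmul_smul, TensorProduct.smul_tmul']
  | add x y hx hy =>
    generalize (Polynomial.degreeLT K N).subtype.lTensor M = f at hx hy ⊢
    rw [map_add f]
    conv_lhs => rw [hx, hy]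
    simp only [map_add, TensorProduct.add_tmul, Finset.sum_add_distrib]

theorem coaction_eq_sum (ρ : RationalGaModule K M) {N : ℕ} (h : ρ.HasDegreeLT N) (m : M) :
    ρ.coaction m = ∑ n ∈ Finset.range N, ρ.coeffOp n m ⊗ₜ[K] (Polynomial.X ^ n : K[X]) :=
  eq_sum_of_mem_range_lTensor_degreeLT N _ (h m)

theorem act_eq_sum (ρ : RationalGaModule K M) {N : ℕ} (h : ρ.HasDegreeLT N)
    (φ : K[X] →ₗ[K] K) :
    ρ.act φ = ∑ n ∈ Finset.range N, φ (Polynomial.X ^ n) • ρ.coeffOp n := by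
  ext m
  rw [act_apply, ρ.coaction_eq_sum h]
  simp

theorem actBaseChange_eq_sum (ρ : RationalGaModule K M) {N : ℕ} (h : ρ.HasDegreeLT N)
    (L : Type u) [Field L] [Algebra K L] (φ : L[X] →ₗ[L] L) :
    ρ.actBaseChange L φ =
      ∑ n ∈ Finset.range N, φ (Polynomial.X ^ n) • (ρ.coeffOp n).baseChange L := by
  ext m
  simp only [actBaseChange, TensorProduct.AlgebraTensorModule.curry_apply,
    LinearMap.restrictScalars_apply, TensorProduct.curry_apply, LinearMap.liftBaseChange_tmul,
    one_smul, LinearMap.comp_apply, ρ.coaction_eq_sum h, map_sum, LinearMap.lTensor_tmul,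
    LinearMap.sum_apply, LinearMap.smul_apply, LinearMap.baseChange_tmul,
    TensorProduct.smul_tmul', smul_eq_mul, mul_one]
  simp

theorem hasDegreeLT_mono (ρ : RationalGaModule K M) {N N' : ℕ} (hN : N ≤ N')
    (h : ρ.HasDegreeLT N) : ρ.HasDegreeLT N' := by
  intro m
  rw [ρ.coaction_eq_sum h]
  refine Submodule.sum_mem _ fun n hn => ?_
  refine ⟨ρ.coeffOp n m ⊗ₜ ⟨Polynomial.X ^ n, ?_⟩, rfl⟩
  rw [Polynomial.mem_degreeLT, Polynomial.degree_X_pow]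
  exact_mod_cast (Finset.mem_range.1 hn).trans_le hN

theorem exists_mem_range_lTensor_degreeLT (y : M ⊗[K] K[X]) :
    ∃ N, ∀ N', N ≤ N' → y ∈ LinearMap.range ((Polynomial.degreeLT K N').subtype.lTensor M) := by
  induction y with
  | zero => exact ⟨0, fun _ _ => Submodule.zero_mem _⟩
  | tmul m q =>
    refine ⟨q.natDegree + 1, fun N' hN => ⟨m ⊗ₜ ⟨q, ?_⟩, rfl⟩⟩
    rw [Polynomial.mem_degreeLT]
    exact Polynomial.degree_le_natDegree.trans_lt (by exact_mod_cast hN)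
  | add x y hx hy =>
    obtain ⟨a, ha⟩ := hx
    obtain ⟨b, hb⟩ := hy
    exact ⟨max a b, fun N' h => Submodule.add_mem _ (ha _ ((le_max_left a b).trans h))
      (hb _ ((le_max_right a b).trans h))⟩

theorem exists_hasDegreeLT (ρ : RationalGaModule K M) [FiniteDimensional K M] :
    ∃ N, ρ.HasDegreeLT N := by
  let b := Module.finBasis K M
  choose d hd using fun i => exists_mem_range_lTensor_degreeLT (ρ.coaction (b i))
  refine ⟨Finset.univ.sup d, fun m => ?_⟩
  rw [← b.sum_repr m, map_sum]
  refine Submodule.sum_mem _ fun i _ => ?_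
  rw [map_smul]
  exact Submodule.smul_mem _ _ (hd i _ (Finset.le_sup (Finset.mem_univ i)))

theorem coeffOp_eq_zero (ρ : RationalGaModule K M) {N : ℕ} (h : ρ.HasDegreeLT N) (n : ℕ)
    (hn : N ≤ n) : ρ.coeffOp n = 0 := by
  rw [coeffOp, ρ.act_eq_sum h]
  refine Finset.sum_eq_zero fun l hl => ?_
  have : n ≠ l := ((Finset.mem_range.1 hl).trans_le hn).ne'
  simp [Polynomial.coeff_X_pow, this]

theorem coeffOp_zero (ρ : RationalGaModule K M) : ρ.coeffOp 0 = 1 := by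
  have h : Polynomial.lcoeff K 0 = (gaCounit K).toLinearMap := by
    ext n
    cases n <;> simp [gaCounit]
  rw [coeffOp, h]
  exact ρ.counit

theorem map_lcoeff_gaComul (a b n : ℕ) :
    LinearMap.mul' K K (TensorProduct.map (Polynomial.lcoeff K a) (Polynomial.lcoeff K b)
      (gaComul K (Polynomial.X ^ n))) = if n = a + b then ((a + b).choose a : K) else 0 := by
  rw [map_pow, gaComul, Polynomial.aeval_X, Commute.add_pow (Commute.all _ _)]
  simp only [Algebra.TensorProduct.tmul_pow, one_pow, Algebra.TensorProduct.tmul_mul_tmul,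
    mul_one, one_mul, map_sum, ← nsmul_eq_mul', map_nsmul, TensorProduct.map_tmul,
    Polynomial.lcoeff_apply, Polynomial.coeff_X_pow, LinearMap.mul'_apply]
  split_ifs with h
  · subst h
    rw [Finset.sum_eq_single a]
    · simp
    · intro k _ hk
      simp [hk.symm]
    · intro hk
      simp at hk
  · refine Finset.sum_eq_zero fun k hk => ?_
    rw [Finset.mem_range] at hk
    split_ifs <;> first | omega | simp

theorem coeffOp_mul (ρ : RationalGaModule K M) {N : ℕ} (h : ρ.HasDegreeLT N) (a b : ℕ) :
    ρ.coeffOp a * ρ.coeffOp b = ((a + b).choose a : K) • ρ.coeffOp (a + b) := by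
  ext m
  -- Coassociativity is contracted with the coefficients of `T ^ a` and `T ^ b`; the binomial
  -- coefficient is that of `T ^ a ⊗ T ^ b` in `(T ⊗ 1 + 1 ⊗ T) ^ (a + b)`.
  have h1 := congrArg (fun f => TensorProduct.rid K M ((LinearMap.mul' K K ∘ₗ
    TensorProduct.map (Polynomial.lcoeff K a) (Polynomial.lcoeff K b)).lTensor M (f m))) ρ.coassoc
  simp only [LinearMap.comp_apply] at h1
  rw [ρ.coaction_eq_sum h m] at h1
  simp only [map_sum, LinearMap.rTensor_tmul, LinearMap.lTensor_tmul, AlgHom.toLinearMap_apply,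
    LinearMap.comp_apply, map_lcoeff_gaComul, TensorProduct.rid_tmul, ρ.coaction_eq_sum h,
    TensorProduct.sum_tmul, LinearEquiv.coe_coe, TensorProduct.assoc_tmul, TensorProduct.map_tmul,
    Polynomial.lcoeff_apply, Polynomial.coeff_X_pow, LinearMap.mul'_apply, mul_ite, mul_one,
    mul_zero, ite_smul, one_smul, zero_smul] at h1
  have hl : ∀ c : ℕ, N ≤ c → ρ.coeffOp c = 0 := ρ.coeffOp_eq_zero h
  have h2 : ∑ n ∈ Finset.range N, (if n = a + b then ((a + b).choose a : K) • ρ.coeffOp n m else 0)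
      = ((a + b).choose a : K) • ρ.coeffOp (a + b) m := by
    rw [Finset.sum_ite_eq']
    split_ifs with hab
    · rfl
    · rw [hl _ (by simpa using hab)]; simp
  rw [h2] at h1
  rw [LinearMap.smul_apply, ← h1, Module.End.mul_apply]
  by_cases hb : b < N
  · rw [Finset.sum_eq_single b (fun n _ hn => Finset.sum_eq_zero fun _ _ => by simp [hn.symm])
      (fun hb' => absurd (Finset.mem_range.2 hb) hb')]
    simp only [if_true]
    by_cases ha : a < N
    · rw [Finset.sum_eq_single a (fun n _ hn => by simp [hn.symm])
        (fun ha' => absurd (Finset.mem_range.2 ha) ha')]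
      simp
    · rw [hl a (not_lt.1 ha), Finset.sum_eq_zero]
      · simp
      · intro n hn
        have : a ≠ n := fun han => ha (han ▸ Finset.mem_range.1 hn)
        simp [this]
  · rw [hl b (not_lt.1 hb), Finset.sum_eq_zero]
    · simp
    · intro n hn
      have : b ≠ n := fun hbn => hb (hbn ▸ Finset.mem_range.1 hn)
      exact Finset.sum_eq_zero fun _ _ => by simp [this]

theorem isDividedPowers (ρ : RationalGaModule K M) {N : ℕ} (h : ρ.HasDegreeLT N) :
    IsDividedPowers N ρ.coeffOp where
  zero := ρ.coeffOp_zero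
  mul := ρ.coeffOp_mul h
  eq_zero := ρ.coeffOp_eq_zero h

theorem isDividedPowers_baseChange (ρ : RationalGaModule K M) {N : ℕ} (h : ρ.HasDegreeLT N)
    (L : Type u) [Field L] [Algebra K L] :
    IsDividedPowers N fun n => (ρ.coeffOp n).baseChange L where
  zero := by
    rw [coeffOp_zero]
    exact LinearMap.baseChange_id
  mul a b := by
    have h1 := congrArg (LinearMap.baseChange L) (ρ.coeffOp_mul h a b)
    rw [Module.End.mul_eq_comp, LinearMap.baseChange_comp, LinearMap.baseChange_smul] at h1
    rw [Module.End.mul_eq_comp, h1, ← algebraMap_smul L, map_natCast]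
  eq_zero n hn := by rw [ρ.coeffOp_eq_zero h n hn, LinearMap.baseChange_zero]

variable (p : ℕ) [Fact p.Prime]

/-- Pushing `u_s` forward along multiplication by `b` scales it by `b ^ p ^ s`. -/
theorem element_eq_sum (σ : GaOneParam K) :
    σ.element p = ∑ s ∈ (σ.coords p).support,
      (σ.coords p s) ^ p ^ s • Polynomial.lcoeff K (p ^ s) := by
  rw [GaOneParam.element, Finsupp.sum]
  refine Finset.sum_congr rfl fun s _ => ?_
  ext n
  simp only [GaOneParam.push, GaOneParam.scaling, LinearMap.comp_apply, AlgHom.toLinearMap_apply,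
    Polynomial.monomial_one_right_eq_X_pow, map_pow, Polynomial.aeval_X, smul_pow,
    Polynomial.lcoeff_apply, Polynomial.coeff_smul, Polynomial.coeff_X_pow, smul_eq_mul,
    LinearMap.smul_apply]
  split_ifs with hn
  · rw [hn]
  · simp

theorem actionAt_eq_sum (ρ : RationalGaModule K M) {N : ℕ} (h : ρ.HasDegreeLT N)
    (σ : GaOneParam K) :
    ρ.actionAt p σ = ∑ s ∈ Finset.range N, (σ.coords p s) ^ p ^ s • ρ.coeffOp (p ^ s) := by
  rw [actionAt, element_eq_sum, act_sum]
  simp only [act_smul]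
  refine (Finset.sum_subset (Finset.subset_union_left (s₂ := Finset.range N)) ?_).trans
    (Finset.sum_subset Finset.subset_union_right ?_).symm
  · intro s _ hs
    rw [Finsupp.notMem_support_iff.1 hs, zero_pow (pow_pos (Fact.out : p.Prime).pos s).ne',
      zero_smul]
  · intro s _ hs
    have h1 : N ≤ p ^ s :=
      (by simpa using hs : N ≤ s).trans (Nat.lt_pow_self (Fact.out : p.Prime).one_lt).le
    exact (congrArg _ (ρ.coeffOp_eq_zero h _ h1)).trans (smul_zero _)

end RationalGaModule

/-! ### Coefficients and primitive elements on the Frobenius kernel -/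

section Frobenius

variable (p r : ℕ) (K : Type u) [Field K]

theorem frobCoeff_mk {i : ℕ} (hi : i < p ^ r) (q : K[X]) :
    frobCoeff p r K i (AdjoinRoot.mk _ q) = q.coeff i := by
  have h := congrArg (fun f => f.coeff i)
    (Polynomial.modByMonic_add_div q (Polynomial.X ^ p ^ r : K[X]))
  simp only [Polynomial.coeff_add, Polynomial.coeff_X_pow_mul', not_le.2 hi, if_false,
    add_zero] at h
  simpa [frobCoeff] using h

variable {p r K} in
theorem frobCoord_ext (x y : FrobCoord p r K)
    (h : ∀ i < p ^ r, frobCoeff p r K i x = frobCoeff p r K i y) : x = y := by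
  obtain ⟨f, rfl⟩ := AdjoinRoot.mk_surjective x
  obtain ⟨g, rfl⟩ := AdjoinRoot.mk_surjective y
  rw [AdjoinRoot.mk_eq_mk, Polynomial.X_pow_dvd_iff]
  intro i hi
  have := h i hi
  rw [frobCoeff_mk p r K hi, frobCoeff_mk p r K hi] at this
  rw [Polynomial.coeff_sub, this, sub_self]

theorem frobCoeff_root_pow {i : ℕ} (hi : i < p ^ r) (n : ℕ) :
    frobCoeff p r K i (AdjoinRoot.root (Polynomial.X ^ p ^ r : K[X]) ^ n) =
      if i = n then 1 else 0 := by
  rw [← AdjoinRoot.mk_X, ← map_pow, frobCoeff_mk p r K hi, Polynomial.coeff_X_pow]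

theorem frobCoeff_one {i : ℕ} (hi : i < p ^ r) :
    frobCoeff p r K i 1 = if i = 0 then 1 else 0 := by
  simpa using frobCoeff_root_pow p r K hi 0

theorem frobCoord_eq_sum (x : FrobCoord p r K) :
    x = ∑ n ∈ Finset.range (p ^ r), frobCoeff p r K n x •
      AdjoinRoot.root (Polynomial.X ^ p ^ r : K[X]) ^ n := by
  refine frobCoord_ext _ _ fun i hi => ?_
  simp [map_sum, frobCoeff_root_pow p r K hi, hi]

variable [Fact p.Prime] [CharP K p]

theorem map_frobCoeff_frobComul {a b : ℕ} (ha : a < p ^ r) (hb : b < p ^ r) (n : ℕ) :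
    LinearMap.mul' K K (TensorProduct.map (frobCoeff p r K a) (frobCoeff p r K b)
      (frobComul p r K (AdjoinRoot.root (Polynomial.X ^ p ^ r : K[X]) ^ n))) =
      if n = a + b then ((a + b).choose a : K) else 0 := by
  rw [map_pow, frobComul_root, Commute.add_pow (Commute.all _ _)]
  simp only [Algebra.TensorProduct.tmul_pow, one_pow, Algebra.TensorProduct.tmul_mul_tmul,
    mul_one, one_mul, map_sum, ← nsmul_eq_mul', map_nsmul, TensorProduct.map_tmul,
    frobCoeff_root_pow p r K ha, frobCoeff_root_pow p r K hb, LinearMap.mul'_apply]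
  split_ifs with h
  · subst h
    rw [Finset.sum_eq_single a]
    · simp
    · intro k _ hk
      simp [hk.symm]
    · intro hk
      simp at hk
  · refine Finset.sum_eq_zero fun k hk => ?_
    rw [Finset.mem_range] at hk
    split_ifs <;> first | omega | simp

/-- A primitive element of the coordinate algebra of the Frobenius kernel has no terms other than
those in `T ^ (p ^ s)`. -/
theorem frobCoeff_eq_zero_of_primitive (x : FrobCoord p r K)
    (hx : frobComul p r K x = x ⊗ₜ[K] 1 + 1 ⊗ₜ[K] x) (n : ℕ) (hn : n < p ^ r)
    (hne : ∀ i, n ≠ p ^ i) : frobCoeff p r K n x = 0 := by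
  -- Comparison of the coefficients of `T ^ a ⊗ T ^ b` on both sides of primitivity. For `a = b = 0`
  -- it gives `x_0 = 2 x_0`; for `a, b > 0` the right side is zero.
  have key : ∀ a b : ℕ, a + b < p ^ r → frobCoeff p r K (a + b) x * ((a + b).choose a : K) =
      frobCoeff p r K a x * frobCoeff p r K b 1 + frobCoeff p r K a 1 * frobCoeff p r K b x := by
    intro a b hab
    have ha : a < p ^ r := (Nat.le_add_right a b).trans_lt hab
    have hb : b < p ^ r := (Nat.le_add_left b a).trans_lt hab
    have h := congrArg (fun y => LinearMap.mul' K K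
      (TensorProduct.map (frobCoeff p r K a) (frobCoeff p r K b) y)) hx
    simp only [map_add, TensorProduct.map_tmul, LinearMap.mul'_apply] at h
    rw [← h]
    conv_rhs => rw [frobCoord_eq_sum p r K x]
    simp only [map_sum, map_smul, map_frobCoeff_frobComul p r K ha hb]
    simp [hab]
  rcases Nat.eq_zero_or_pos n with rfl | h0
  · have := key 0 0 hn
    simpa [frobCoeff_one p r K hn] using this
  · obtain ⟨i, hi, hd⟩ := exists_not_dvd_choose_of_ne_pow (p := p) n h0 hne
    have hi0 : 0 < p ^ i := pow_pos (Fact.out : p.Prime).pos i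
    have h1 : p ^ i + (n - p ^ i) = n := Nat.add_sub_cancel' hi.le
    have := key (p ^ i) (n - p ^ i) (by rwa [h1])
    rw [h1, frobCoeff_one p r K (hi.trans hn),
      frobCoeff_one p r K ((Nat.sub_le n _).trans_lt hn), if_neg hi0.ne',
      if_neg (Nat.sub_pos_of_lt hi).ne', mul_zero, zero_mul, add_zero] at this
    exact (mul_eq_zero.1 this).resolve_right fun h => hd ((CharP.cast_eq_zero_iff K p _).1 h)

end Frobenius

theorem sum_pow_prime_pow_of_algebra (K : Type u) [Field K] (p : ℕ) [Fact p.Prime] [CharP K p]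
    {A : Type v} [CommRing A] [Algebra K A] (n : ℕ) {ι : Type*} (s : Finset ι) (x : ι → A) :
    (∑ i ∈ s, x i) ^ p ^ n = ∑ i ∈ s, x i ^ p ^ n := by
  classical
  induction s using Finset.induction_on with
  | empty => simp [(Fact.out : p.Prime).ne_zero]
  | insert i s hi ih =>
    rw [Finset.sum_insert hi, Finset.sum_insert hi, add_pow_prime_pow_of_algebra K, ih]

/-! ### Infinitesimal one-parameter subgroups in coordinates -/

namespace GaInfOneParam

variable {p r : ℕ} [Fact p.Prime] {K : Type u} [Field K] [CharP K p]

theorem comap_X_eq_sum (μ : GaInfOneParam p r K) : μ.comap Polynomial.X =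
    ∑ s, μ.coords s • AdjoinRoot.root (Polynomial.X ^ p ^ r : K[X]) ^ p ^ (s : ℕ) := by
  have hp := (Fact.out : p.Prime)
  have hprim : frobComul p r K (μ.comap Polynomial.X) =
      μ.comap Polynomial.X ⊗ₜ[K] 1 + 1 ⊗ₜ[K] μ.comap Polynomial.X := by
    have := congrArg (fun f => f Polynomial.X) μ.comap_comul
    simpa [gaComul] using this
  refine frobCoord_ext _ _ fun n hn => ?_
  simp only [map_sum, map_smul, frobCoeff_root_pow p r K hn, smul_eq_mul]
  by_cases h : ∀ i, n ≠ p ^ i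
  · rw [frobCoeff_eq_zero_of_primitive p r K _ hprim n hn h]
    simp [h]
  · push Not at h
    obtain ⟨i, rfl⟩ := h
    have hi : i < r := (Nat.pow_lt_pow_iff_right hp.one_lt).1 hn
    rw [Finset.sum_eq_single ⟨i, hi⟩]
    · simp [coords]
    · intro s _ hs
      have : p ^ i ≠ p ^ (s : ℕ) := fun h => hs (Fin.ext
        (Nat.pow_right_injective hp.two_le h).symm)
      simp [this]
    · simp

theorem coords_ofCoords (b : Fin r → K) : (ofCoords p b).coords = b := by
  have hp := (Fact.out : p.Prime)
  ext i
  have hi : p ^ (i : ℕ) < p ^ r := Nat.pow_lt_pow_right hp.one_lt i.2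
  simp only [coords, ofCoords, Polynomial.aeval_X, map_sum, map_smul,
    frobCoeff_root_pow p r K hi, smul_eq_mul]
  rw [Finset.sum_eq_single i]
  · simp
  · intro s _ hs
    have : p ^ (i : ℕ) ≠ p ^ (s : ℕ) := fun h => hs (Fin.ext
      (Nat.pow_right_injective hp.two_le h).symm)
    simp [this]
  · simp

theorem ofCoords_coords (μ : GaInfOneParam p r K) : ofCoords p μ.coords = μ := by
  refine GaInfOneParam.ext (Polynomial.algHom_ext ?_)
  rw [comap_X_eq_sum μ, ofCoords, Polynomial.aeval_X]

theorem coords_reverse (μ : GaInfOneParam p r K) (s : Fin r) :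
    μ.reverse.coords s = μ.coords s.rev := by
  rw [reverse, coords_ofCoords]

theorem reverse_reverse (μ : GaInfOneParam p r K) : μ.reverse.reverse = μ := by
  conv_rhs => rw [← ofCoords_coords μ]
  conv_lhs => rw [reverse]
  congr 1
  ext s
  rw [coords_reverse, Fin.rev_rev]

theorem element_one (μ : GaInfOneParam p r K) (hr : 0 < r) : μ.element (Polynomial.X ^ 0) = 0 := by
  have hp := (Fact.out : p.Prime)
  have h1 : p ^ (r - 1) < p ^ r := Nat.pow_lt_pow_right hp.one_lt (Nat.sub_lt hr one_pos)
  rw [element, LinearMap.comp_apply, pow_zero, AlgHom.toLinearMap_apply, map_one,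
    frobCoeff_one p r K h1, if_neg (pow_pos hp.pos _).ne']

/-- This is where the reversal of coordinates comes from. Raising to the power `p ^ i` is additive,
so `(∑ b_s T ^ p ^ s) ^ p ^ i = ∑ b_s ^ p ^ i T ^ p ^ (s + i)`, and the coefficient of `T ^ p ^ (r -
1)` is met only at `s = r - 1 - i`. -/
theorem element_X_pow (μ : GaInfOneParam p r K) (i : ℕ) (hi : i < r) :
    μ.element (Polynomial.X ^ p ^ i) = μ.coords (Fin.rev ⟨i, hi⟩) ^ p ^ i := by
  have hp := (Fact.out : p.Prime)
  have h1 : p ^ (r - 1) < p ^ r :=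
    Nat.pow_lt_pow_right hp.one_lt (Nat.sub_lt (i.zero_le.trans_lt hi) one_pos)
  rw [element, LinearMap.comp_apply, AlgHom.toLinearMap_apply, map_pow, comap_X_eq_sum,
    sum_pow_prime_pow_of_algebra K]
  simp only [smul_pow, ← pow_mul, ← pow_add, map_sum, map_smul, frobCoeff_root_pow p r K h1,
    smul_eq_mul]
  rw [Finset.sum_eq_single (Fin.rev ⟨i, hi⟩)]
  · rw [if_pos, mul_one]
    rw [Fin.val_rev]
    congr 1
    simp only
    omega
  · intro s _ hs
    rw [if_neg, mul_zero]
    intro h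
    have h2 := Nat.pow_right_injective hp.two_le h
    refine hs (Fin.ext ?_)
    rw [Fin.val_rev]
    simp only at h2 ⊢
    omega
  · simp

/-- No `s ≥ 0` satisfies `s + i = r - 1`. This makes the linear part involve only `i < r` even when
the module has large degree. -/
theorem element_X_pow_of_le (μ : GaInfOneParam p r K) (hr : 0 < r) (i : ℕ) (hi : r ≤ i) :
    μ.element (Polynomial.X ^ p ^ i) = 0 := by
  have hp := (Fact.out : p.Prime)
  have h1 : p ^ (r - 1) < p ^ r := Nat.pow_lt_pow_right hp.one_lt (Nat.sub_lt hr one_pos)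
  rw [element, LinearMap.comp_apply, AlgHom.toLinearMap_apply, map_pow, comap_X_eq_sum,
    sum_pow_prime_pow_of_algebra K]
  simp only [smul_pow, ← pow_mul, ← pow_add, map_sum, map_smul, frobCoeff_root_pow p r K h1,
    smul_eq_mul]
  refine Finset.sum_eq_zero fun s _ => ?_
  rw [if_neg, mul_zero]
  intro h
  have h2 := Nat.pow_right_injective hp.two_le h
  omega

end GaInfOneParam

/-! ### One-parameter subgroups in coordinates -/

namespace GaOneParam

variable (p : ℕ) [Fact p.Prime] {K : Type u} [Field K]

theorem coords_apply (σ : GaOneParam K) (s : ℕ) :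
    σ.coords p s = (σ.comap Polynomial.X).coeff (p ^ s) := rfl

variable [CharP K p]

theorem coords_pr (r : ℕ) (σ : GaOneParam K) (s : Fin r) : (σ.pr p r).coords s = σ.coords p s := by
  rw [coords_apply, GaInfOneParam.coords, pr, AlgHom.comp_apply]
  exact frobCoeff_mk p r K (Nat.pow_lt_pow_right (Fact.out : p.Prime).one_lt s.2) _

/-- The 1-parameter subgroup `T ↦ ∑ s, a_s T ^ (p ^ s)`. -/
def ofCoords (a : ℕ →₀ K) : GaOneParam K where
  comap := Polynomial.aeval (a.sum fun s c => c • (Polynomial.X : K[X]) ^ p ^ s)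
  comap_comul := by
    ext
    simp [Finsupp.sum, gaComul, add_pow_prime_pow_of_algebra K p,
      Algebra.TensorProduct.tmul_pow, smul_add, Finset.sum_add_distrib, TensorProduct.sum_tmul,
      TensorProduct.tmul_sum, TensorProduct.smul_tmul']

theorem coords_ofCoords (a : ℕ →₀ K) : (ofCoords p a).coords p = a := by
  ext s
  rw [coords_apply, ofCoords, Polynomial.aeval_X, Finsupp.sum, Polynomial.finsetSum_coeff]
  simp only [Polynomial.coeff_smul, Polynomial.coeff_X_pow, smul_eq_mul,
    (Nat.pow_right_injective (Fact.out : p.Prime).two_le).eq_iff, mul_ite, mul_one, mul_zero,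
    Finset.sum_ite_eq]
  simp +contextual [Finsupp.mem_support_iff, eq_comm]

end GaOneParam

/-! ### Ranks through minors, and their behaviour under field extension -/

section Minors

theorem exists_rank_submatrix_cols {K : Type*} [Field K] {m n : Type*} [Fintype m] [Fintype n]
    (A : Matrix m n K) {d : ℕ} (h : d ≤ A.rank) :
    ∃ c : Fin d → n, LinearIndependent K (A.submatrix id c).col := by
  obtain ⟨κ, a, ha, hspan, hli⟩ := exists_linearIndependent' K A.col
  have : Finite κ := Finite.of_injective a ha
  have : Fintype κ := Fintype.ofFinite κ
  have hcard : A.rank = Fintype.card κ := by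
    rw [Matrix.rank_eq_finrank_span_cols, ← hspan, finrank_span_eq_card hli]
  let e : Fin d ↪ κ := (Fin.castLEEmb (h.trans hcard.le)).trans (Fintype.equivFin κ).symm.toEmbedding
  exact ⟨a ∘ e, hli.comp e e.injective⟩

/-- The rank is at least `d` if and only if some minor of size `d` does not vanish. -/
theorem le_rank_iff_exists_minor {K : Type*} [Field K] {m n : Type*} [Fintype m] [Fintype n]
    (A : Matrix m n K) (d : ℕ) :
    d ≤ A.rank ↔ ∃ (r : Fin d → m) (c : Fin d → n), (A.submatrix r c).det ≠ 0 := by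
  constructor
  · intro h
    obtain ⟨c, hc⟩ := exists_rank_submatrix_cols A h
    have h1 : d ≤ (A.submatrix id c).transpose.rank := by
      rw [Matrix.rank_transpose, Matrix.rank_eq_finrank_span_cols, finrank_span_eq_card hc,
        Fintype.card_fin]
    obtain ⟨r, hr⟩ := exists_rank_submatrix_cols _ h1
    refine ⟨r, c, ?_⟩
    rw [Matrix.linearIndependent_cols_iff_isUnit, Matrix.isUnit_iff_isUnit_det,
      Matrix.transpose_submatrix, Matrix.submatrix_submatrix, ← Matrix.det_transpose] at hr
    exact hr.ne_zero
  · rintro ⟨r, c, h⟩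
    have h1 := Matrix.rank_of_isUnit (A.submatrix r c)
      ((Matrix.isUnit_iff_isUnit_det _).2 (isUnit_iff_ne_zero.2 h))
    rw [Fintype.card_fin] at h1
    exact h1.symm.le.trans (Matrix.rank_submatrix_le A r c)

variable {k : Type*} [Field k] {σ : Type*} [Fintype σ] {ι : Type*} [Fintype ι] [DecidableEq ι]

/-- The `j`-th power of the generic linear combination of the matrices `A i`. -/
def genericPower (A : σ → Matrix ι ι k) (j : ℕ) : Matrix ι ι (MvPolynomial σ k) :=
  (∑ i, (MvPolynomial.X i : MvPolynomial σ k) • (A i).map MvPolynomial.C) ^ j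

/-- A minor of the `j`-th power of the generic linear combination of the matrices `A i`. -/
def powerMinor (A : σ → Matrix ι ι k) (j : ℕ) {d : ℕ} (r c : Fin d → ι) : MvPolynomial σ k :=
  ((genericPower A j).submatrix r c).det

theorem aeval_powerMinor (A : σ → Matrix ι ι k) (j : ℕ) {d : ℕ} (r c : Fin d → ι)
    (L : Type*) [Field L] [Algebra k L] (x : σ → L) :
    MvPolynomial.aeval x (powerMinor A j r c) =
      (((∑ i, x i • (A i).map (algebraMap k L)) ^ j).submatrix r c).det := by
  have h := RingHom.map_det (MvPolynomial.aeval x : MvPolynomial σ k →ₐ[k] L).toRingHom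
    ((genericPower A j).submatrix r c)
  refine h.trans (congrArg Matrix.det ?_)
  rw [RingHom.mapMatrix_apply, ← Matrix.submatrix_map, genericPower, Matrix.map_pow]
  congr 2
  ext a b
  simp [Matrix.sum_apply]

variable {M : Type*} [AddCommGroup M] [Module k M]

/-- The minors are polynomials over `k` in the coefficients `x`, so one family of polynomials
controls the `j`-rank over all extension fields at once. -/
theorem le_jRank_iff_exists_powerMinor (b : Module.Basis ι k M) (U : σ → Module.End k M) (j d : ℕ)
    {L : Type*} [Field L] [Algebra k L] {W : Type*} [AddCommGroup W] [Module L W]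
    (b' : Module.Basis ι L W) (U' : σ → Module.End L W)
    (hU : ∀ i, LinearMap.toMatrix b' b' (U' i) =
      (LinearMap.toMatrix b b (U i)).map (algebraMap k L)) (x : σ → L) :
    d ≤ jRank j (∑ i, x i • U' i) ↔ ∃ r c : Fin d → ι, MvPolynomial.aeval x
      (powerMinor (fun i => LinearMap.toMatrix b b (U i)) j r c) ≠ 0 := by
  have h : jRank j (∑ i, x i • U' i) =
      ((∑ i, x i • (LinearMap.toMatrix b b (U i)).map (algebraMap k L)) ^ j).rank := by
    rw [jRank, Matrix.rank_eq_finrank_range_toLin _ b' b']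
    have h1 : Matrix.toLin b' b' ((∑ i, x i • (LinearMap.toMatrix b b (U i)).map
        (algebraMap k L)) ^ j) = (∑ i, x i • U' i) ^ j := by
      rw [← Matrix.toLin_toMatrix b' b' ((∑ i, x i • U' i) ^ j), ← LinearMap.toMatrix_pow, map_sum]
      simp only [map_smul, hU]
    rw [h1]
  rw [h, le_rank_iff_exists_minor]
  simp only [aeval_powerMinor]

theorem le_jRank_iff_exists_powerMinor_self (b : Module.Basis ι k M) (U : σ → Module.End k M)
    (j d : ℕ) (x : σ → k) :
    d ≤ jRank j (∑ i, x i • U i) ↔ ∃ r c : Fin d → ι, MvPolynomial.eval x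
      (powerMinor (fun i => LinearMap.toMatrix b b (U i)) j r c) ≠ 0 := by
  have := le_jRank_iff_exists_powerMinor b U j d b U (fun i => by ext; simp) x
  simpa only [MvPolynomial.aeval_eq_eval] using this

variable (L : Type*) [Field L] [Algebra k L]

theorem le_jRank_iff_exists_powerMinor_baseChange (b : Module.Basis ι k M)
    (U : σ → Module.End k M) (j d : ℕ) (x : σ → L) :
    d ≤ jRank j (∑ i, x i • (U i).baseChange L) ↔ ∃ r c : Fin d → ι, MvPolynomial.aeval x
      (powerMinor (fun i => LinearMap.toMatrix b b (U i)) j r c) ≠ 0 :=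
  le_jRank_iff_exists_powerMinor b U j d (Algebra.TensorProduct.basis L b) _
    (fun i => LinearMap.toMatrix_baseChange L (U i) b b) x

variable [FiniteDimensional k M]

/-- A bound for the `j`-ranks of linear combinations persists under field extension. -/
theorem jRank_baseChange_le [Infinite k] (U : σ → Module.End k M) (j R : ℕ)
    (h : ∀ x : σ → k, jRank j (∑ i, x i • U i) ≤ R) (x : σ → L) :
    jRank j (∑ i, x i • (U i).baseChange L) ≤ R := by
  classical
  let b := Module.finBasis k M
  by_contra! hlt
  obtain ⟨r, c, hrc⟩ := (le_jRank_iff_exists_powerMinor_baseChange L b U j (R + 1) x).1 hlt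
  have hne : powerMinor (fun i => LinearMap.toMatrix b b (U i)) j r c ≠ 0 := by
    intro h0
    rw [h0, map_zero] at hrc
    exact hrc rfl
  obtain ⟨y, hy⟩ : ∃ y : σ → k,
      MvPolynomial.eval y (powerMinor (fun i => LinearMap.toMatrix b b (U i)) j r c) ≠ 0 := by
    by_contra! h0
    exact hne (MvPolynomial.funext fun y => by rw [h0, map_zero])
  exact absurd ((le_jRank_iff_exists_powerMinor_self b U j (R + 1) y).2 ⟨r, c, hy⟩)
    (not_le.2 (Nat.lt_succ_of_le (h y)))

/-- If all non-trivial linear combinations over an algebraically closed field have `j`-rank at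
least `R`, then the same holds over all extension fields. -/
theorem le_jRank_baseChange [IsAlgClosed k] (U : σ → Module.End k M) (j R : ℕ)
    (h : ∀ x : σ → k, x ≠ 0 → R ≤ jRank j (∑ i, x i • U i)) (x : σ → L) (hx : x ≠ 0) :
    R ≤ jRank j (∑ i, x i • (U i).baseChange L) := by
  classical
  let b := Module.finBasis k M
  rw [le_jRank_iff_exists_powerMinor_baseChange L b U j R x]
  by_contra! hall
  let I : Ideal (MvPolynomial σ k) := Ideal.span {f | ∃ r c : Fin R → Fin (Module.finrank k M),
    f = powerMinor (fun i => LinearMap.toMatrix b b (U i)) j r c}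
  have hI : I ≤ RingHom.ker (MvPolynomial.aeval x : MvPolynomial σ k →ₐ[k] L) := by
    refine Ideal.span_le.2 ?_
    rintro _ ⟨r, c, rfl⟩
    exact hall r c
  refine hx (funext fun i => ?_)
  -- By hypothesis the minors have no common zero over `k` except possibly the origin, so the
  -- Nullstellensatz puts a power of each variable in the ideal they generate; a common zero over
  -- `L` must then be the origin too.
  have hX : (MvPolynomial.X i : MvPolynomial σ k) ∈ I.radical := by
    rw [← MvPolynomial.vanishingIdeal_zeroLocus_eq_radical (K := k),
      MvPolynomial.mem_vanishingIdeal_iff]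
    intro y hy
    rw [MvPolynomial.mem_zeroLocus_iff] at hy
    have hy0 : y = 0 := by
      by_contra hne
      obtain ⟨r, c, hrc⟩ := (le_jRank_iff_exists_powerMinor_self b U j R y).1 (h y hne)
      exact hrc (by
        have h0 := hy _ (Ideal.subset_span ⟨r, c, rfl⟩)
        rwa [MvPolynomial.aeval_eq_eval] at h0)
    simp [hy0]
  obtain ⟨n, hn⟩ := hX
  have := hI hn
  rw [RingHom.mem_ker, map_pow, MvPolynomial.aeval_X] at this
  exact IsNilpotent.eq_zero ⟨n, this⟩

end Minors

/-! ### Ranks of powers, freeness and Jordan blocks -/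

section NilpotentOperators

variable {K : Type u} [Field K] {M : Type v} [AddCommGroup M] [Module K M]

/-- The dimension of `ker f ∩ im (f ^ i)`, which is the number of Jordan blocks of size `> i` if
`f` is nilpotent. -/
def kerRangeDim (f : Module.End K M) (i : ℕ) : ℕ :=
  Module.finrank K (LinearMap.ker f ⊓ LinearMap.range (f ^ i) : Submodule K M)

theorem range_pow_succ_le (f : Module.End K M) (i : ℕ) :
    LinearMap.range (f ^ (i + 1)) ≤ LinearMap.range (f ^ i) := by
  rw [pow_succ]
  exact LinearMap.range_comp_le_range f (f ^ i)

theorem jRank_zero (f : Module.End K M) : jRank 0 f = Module.finrank K M := by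
  rw [jRank, pow_zero, Module.End.one_eq_id, LinearMap.range_id, finrank_top]

theorem jRank_zero_right {j : ℕ} (hj : 1 ≤ j) : jRank j (0 : Module.End K M) = 0 := by
  rw [jRank, zero_pow (by omega), LinearMap.range_zero, finrank_bot]

variable [FiniteDimensional K M]

theorem kerRangeDim_antitone (f : Module.End K M) : Antitone (kerRangeDim f) :=
  antitone_nat_of_succ_le fun i => Submodule.finrank_mono
    (inf_le_inf_left _ (range_pow_succ_le f i))

/-- Rank-nullity for the restriction of `f` to the range of `f ^ i`. -/
theorem jRank_eq_jRank_succ_add (f : Module.End K M) (i : ℕ) :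
    jRank i f = jRank (i + 1) f + kerRangeDim f i := by
  let g := f.domRestrict (LinearMap.range (f ^ i))
  have h := LinearMap.finrank_range_add_finrank_ker g
  have h1 : LinearMap.range g = LinearMap.range (f ^ (i + 1)) := by
    rw [LinearMap.range_domRestrict, pow_succ', Module.End.mul_eq_comp, LinearMap.range_comp]
  have h2 : Module.finrank K (LinearMap.ker g) = kerRangeDim f i := by
    rw [kerRangeDim, LinearMap.ker_domRestrict, inf_comm, ← Submodule.map_comap_subtype]
    exact (LinearEquiv.finrank_eq (Submodule.equivMapOfInjective _
      (Submodule.injective_subtype _) _))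
  rw [h1, h2] at h
  exact h.symm

theorem jRank_eq_zero_iff (j : ℕ) (f : Module.End K M) : jRank j f = 0 ↔ f ^ j = 0 := by
  rw [jRank, Submodule.finrank_eq_zero, LinearMap.range_eq_bot]

theorem jRank_le_add_mul (f : Module.End K M) (i n : ℕ) :
    jRank i f ≤ jRank (i + n) f + n * kerRangeDim f i := by
  induction n with
  | zero => simp
  | succ n ih =>
    have h1 := jRank_eq_jRank_succ_add f (i + n)
    have h2 := kerRangeDim_antitone f (Nat.le_add_right i n)
    rw [add_mul, one_mul, ← add_assoc i n 1]
    omega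

theorem jRank_add_mul_le (f : Module.End K M) (i : ℕ) :
    jRank i f + i * kerRangeDim f i ≤ Module.finrank K M := by
  induction i with
  | zero => simp [jRank_zero]
  | succ i ih =>
    have h1 := jRank_eq_jRank_succ_add f i
    have h2 := Nat.mul_le_mul_left (i + 1) (kerRangeDim_antitone f (Nat.le_succ i))
    rw [Nat.succ_eq_add_one, add_mul i 1 (kerRangeDim f i), one_mul] at h2
    omega

/-- The maximal possible `j`-rank of an operator whose `p`-th power vanishes. -/
theorem mul_jRank_le {p : ℕ} (f : Module.End K M) (hf : f ^ p = 0) (j : ℕ) (hj : j ≤ p) :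
    p * jRank j f ≤ (p - j) * Module.finrank K M := by
  obtain ⟨n, rfl⟩ := Nat.exists_eq_add_of_le hj
  -- The rank drops are nonincreasing. With `κ` the drop at step `j` and `n = p - j`, the drops from
  -- `j` on give `rank (f ^ j) ≤ n κ`, and those before give `rank (f ^ j) + j κ ≤ dim`; eliminating
  -- `κ` yields the bound.
  have h1 := jRank_le_add_mul f j n
  have h2 := jRank_add_mul_le f j
  rw [(jRank_eq_zero_iff (j + n) f).2 hf, zero_add] at h1
  rw [Nat.add_sub_cancel_left]
  nlinarith

/-- Equality in the previous bound forces all rank drops to coincide, so the last one, which is the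
rank of `f ^ (p - 1)`, is a `p`-th of the dimension. -/
theorem finrank_le_mul_jRank_of_eq {p : ℕ} (f : Module.End K M) (hf : f ^ p = 0) (j : ℕ)
    (hj : 1 ≤ j) (hjp : j < p) (h : (p - j) * Module.finrank K M ≤ p * jRank j f) :
    Module.finrank K M ≤ p * jRank (p - 1) f := by
  obtain ⟨n, rfl⟩ := Nat.exists_eq_add_of_lt hjp
  have h1 := jRank_le_add_mul f j (n + 1)
  have h2 := jRank_add_mul_le f j
  have h3 := jRank_le_add_mul f j n
  rw [← add_assoc, (jRank_eq_zero_iff (j + n + 1) f).2 hf, zero_add] at h1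
  have e1 : j + n + 1 - j = n + 1 := by omega
  have e2 : j + n + 1 - 1 = j + n := by omega
  rw [e1] at h
  rw [e2]
  have h4 : (n + 1) * kerRangeDim f j ≤ jRank j f := by
    have : j * ((n + 1) * kerRangeDim f j) ≤ j * jRank j f := by nlinarith
    exact le_of_mul_le_mul_left this hj
  have h5 : kerRangeDim f j ≤ jRank (j + n) f := by nlinarith
  have h6 : (n + 1) * Module.finrank K M ≤ (n + 1) * ((j + n + 1) * kerRangeDim f j) := by nlinarith
  have h7 := le_of_mul_le_mul_left h6 (Nat.succ_pos n)
  exact h7.trans (Nat.mul_le_mul_left _ h5)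

/-- Generators are preimages under `f ^ (p - 1)` of a basis of its range. Their translates by powers
of `f` are independent, and the hypothesis says that there are enough of them. -/
theorem actsFreely_of_finrank_le {p : ℕ} (hp : 0 < p) (f : Module.End K M) (hf : f ^ p = 0)
    (h : Module.finrank K M ≤ p * jRank (p - 1) f) : ActsFreely p f := by
  let e := Module.finBasis K (LinearMap.range (f ^ (p - 1)))
  choose m hm using fun i => (e i).2
  -- `ULift` only places the index set in the universe that `ActsFreely` asks for.
  let w : ULift.{v} (Fin (Module.finrank K (LinearMap.range (f ^ (p - 1))))) × Fin p → M :=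
    fun x => (f ^ (x.2 : ℕ)) (m x.1.down)
  have hli : LinearIndependent K w := by
    rw [Fintype.linearIndependent_iff]
    intro c hc
    have key : ∀ (s : ℕ) (hs : s < p) i, c (i, ⟨s, hs⟩) = 0 := by
      intro s
      induction s using Nat.strong_induction_on with
      | _ s ih =>
        intro hs i
        -- This power sends the terms at `s` to basis vectors of the range of `f ^ (p - 1)` and
        -- kills those beyond `s`; the terms before `s` have zero coefficient by induction.
        have h1 := congrArg (f ^ (p - 1 - s)) hc
        rw [map_zero, map_sum, Fintype.sum_prod_type] at h1
        have h2 : ∀ x : ULift.{v} (Fin (Module.finrank K (LinearMap.range (f ^ (p - 1))))),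
            ∑ y : Fin p, (f ^ (p - 1 - s)) (c (x, y) • w (x, y)) =
              c (x, ⟨s, hs⟩) • ((e x.down : LinearMap.range (f ^ (p - 1))) : M) := by
          intro x
          rw [Finset.sum_eq_single ⟨s, hs⟩]
          · rw [map_smul, ← hm, ← Module.End.mul_apply, ← pow_add]
            congr 3
            simp only
            omega
          · intro y _ hy
            rcases lt_or_gt_of_ne (fun h => hy (Fin.ext h) : (y : ℕ) ≠ s) with hlt | hgt
            · rw [ih y hlt y.2, zero_smul, map_zero]
            · have h3 : p - 1 - s + (y : ℕ) = (p - 1 - s + y - p) + p := by omega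
              rw [map_smul, ← Module.End.mul_apply, ← pow_add, h3, pow_add, hf, mul_zero,
                LinearMap.zero_apply, smul_zero]
          · simp
        simp only [h2] at h1
        have h3 : ∑ x, c (ULift.up x, ⟨s, hs⟩) • e x = 0 := by
          refine Subtype.ext ?_
          rw [Submodule.coe_sum]
          simp only [Submodule.coe_smul, Submodule.coe_zero]
          rw [← h1]
          exact (Equiv.ulift.symm.sum_comp fun x : ULift.{v} (Fin _) =>
            c (x, ⟨s, hs⟩) • ((e x.down : LinearMap.range (f ^ (p - 1))) : M))
        exact Fintype.linearIndependent_iff.1 e.linearIndependent _ h3 i.down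
    rintro ⟨i, s⟩
    exact key s s.2 i
  have hcard : Fintype.card (ULift.{v} (Fin (Module.finrank K (LinearMap.range (f ^ (p - 1))))) ×
      Fin p) = Module.finrank K M := by
    refine le_antisymm hli.fintype_card_le_finrank ?_
    rw [Fintype.card_prod, Fintype.card_ulift, Fintype.card_fin, Fintype.card_fin, mul_comm]
    exact h
  rcases isEmpty_or_nonempty
    (ULift.{v} (Fin (Module.finrank K (LinearMap.range (f ^ (p - 1))))) × Fin p) with he | he
  · rw [Fintype.card_eq_zero] at hcard
    have := Module.finrank_zero_iff.1 hcard.symm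
    exact ⟨hf, ULift.{v} (Fin _), fun i => m i.down, Module.Basis.empty M,
      fun i s => Subsingleton.elim _ _⟩
  · exact ⟨hf, ULift.{v} (Fin _), fun i => m i.down,
      basisOfLinearIndependentOfCardEqFinrank hli hcard,
      fun i s => by simp [w]⟩

/-- The basis vectors `f ^ (j + s) (m i)` with `s < p - j` lie in the range of `f ^ j`. -/
theorem le_mul_jRank_of_actsFreely {p : ℕ} (f : Module.End K M) (h : ActsFreely p f) (j : ℕ)
    (hjp : j < p) : (p - j) * Module.finrank K M ≤ p * jRank j f := by
  obtain ⟨-, ι, m, b, hb⟩ := h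
  have hfin : Finite (ι × Fin p) := Module.Finite.finite_basis b
  have : Nonempty (Fin p) := ⟨⟨j, hjp⟩⟩
  have : Finite ι := Finite.of_surjective (Prod.fst : ι × Fin p → ι) Prod.fst_surjective
  have : Fintype ι := Fintype.ofFinite ι
  rw [Module.finrank_eq_card_basis b, Fintype.card_prod, Fintype.card_fin]
  let w : ι × Fin (p - j) → LinearMap.range (f ^ j) := fun x =>
    ⟨(f ^ j) ((f ^ (x.2 : ℕ)) (m x.1)), ⟨_, rfl⟩⟩
  let e : ι × Fin (p - j) → ι × Fin p := fun x => (x.1, ⟨j + x.2, by omega⟩)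
  have he : Function.Injective e := by
    rintro ⟨i, s⟩ ⟨i', s'⟩ h
    simp only [e, Prod.mk.injEq, Fin.mk.injEq, Nat.add_left_cancel_iff] at h
    exact Prod.ext h.1 (Fin.ext h.2)
  have hw : (LinearMap.range (f ^ j)).subtype ∘ w = b ∘ e := by
    ext ⟨i, s⟩
    simp only [Function.comp_apply, w, e, Submodule.subtype_apply, hb, ← Module.End.mul_apply,
      ← pow_add]
  have hli : LinearIndependent K w :=
    LinearIndependent.of_comp _ (hw ▸ b.linearIndependent.comp e he)
  have h1 := hli.fintype_card_le_finrank
  rw [Fintype.card_prod, Fintype.card_fin] at h1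
  calc (p - j) * (Fintype.card ι * p) = p * (Fintype.card ι * (p - j)) := by ring
    _ ≤ p * jRank j f := Nat.mul_le_mul_left p h1

/-- An operator `f` with `f ^ p = 0` acts freely if and only if it has the maximal possible
`j`-rank. -/
theorem actsFreely_iff {p : ℕ} (f : Module.End K M) (hf : f ^ p = 0) (j : ℕ)
    (hj : 1 ≤ j) (hjp : j < p) :
    ActsFreely p f ↔ p * jRank j f = (p - j) * Module.finrank K M :=
  ⟨fun h => le_antisymm (mul_jRank_le f hf j hjp.le) (le_mul_jRank_of_actsFreely f h j hjp),
    fun h => actsFreely_of_finrank_le (by omega) f hf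
      (finrank_le_mul_jRank_of_eq f hf j hj hjp h.ge)⟩

/-- An operator acts freely if and only if all its Jordan blocks have size `p`. -/
theorem actsFreely_iff_exists_hasJordanBlocks {p : ℕ} (hp : 0 < p) (f : Module.End K M) :
    ActsFreely p f ↔ ∃ (n : ℕ) (ℓ : Fin n → ℕ), HasJordanBlocks f ℓ ∧ ∀ i, ℓ i = p := by
  constructor
  · rintro ⟨hf, ι, m, b, hb⟩
    have hfin : Finite (ι × Fin p) := Module.Finite.finite_basis b
    have : Nonempty (Fin p) := ⟨⟨0, hp⟩⟩
    have : Finite ι := Finite.of_surjective (Prod.fst : ι × Fin p → ι) Prod.fst_surjective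
    have : Fintype ι := Fintype.ofFinite ι
    let e := Fintype.equivFin ι
    refine ⟨Fintype.card ι, fun _ => p, ⟨fun _ => hp, b.reindex
      ((e.prodCongr (Equiv.refl (Fin p))).trans (Equiv.sigmaEquivProd _ _).symm), ?_⟩, fun _ => rfl⟩
    intro i s
    simp only [Module.Basis.reindex_apply, Equiv.symm_trans_apply, Equiv.symm_symm,
      Equiv.sigmaEquivProd_apply, Equiv.prodCongr_symm, Equiv.prodCongr_apply, Equiv.refl_symm,
      Equiv.coe_refl, Prod.map_apply, id_eq, hb]
    rw [← Module.End.mul_apply, ← pow_succ']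
    split_ifs with h
    · rfl
    · have h1 : (s : ℕ) + 1 = p := by omega
      rw [h1, hf, LinearMap.zero_apply]
  · rintro ⟨n, ℓ, ⟨-, b, hb⟩, hℓ⟩
    obtain rfl : ℓ = fun _ => p := funext hℓ
    have hpow : ∀ (i : Fin n) (s : ℕ) (hs : s < p), (f ^ s) (b ⟨i, ⟨0, hp⟩⟩) = b ⟨i, ⟨s, hs⟩⟩ := by
      intro i s
      induction s with
      | zero => intro _; rfl
      | succ s ih =>
        intro hs
        rw [pow_succ', Module.End.mul_apply, ih (Nat.lt_of_succ_lt hs), hb, dif_pos hs]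
    refine ⟨b.ext fun ⟨i, s⟩ => ?_, ULift.{v} (Fin n), fun i => b ⟨i.down, ⟨0, hp⟩⟩,
      b.reindex ((Equiv.sigmaEquivProd _ _).trans
        (Equiv.ulift.symm.prodCongr (Equiv.refl (Fin p)))), fun i s => ?_⟩
    · have h2 := hb i ⟨p - 1, Nat.sub_lt hp one_pos⟩
      rw [dif_neg (by simp only; omega)] at h2
      rw [← hpow i s s.2, ← Module.End.mul_apply, ← pow_add, add_comm p, pow_add,
        Module.End.mul_apply]
      have h3 : f ^ p = f * f ^ (p - 1) := by rw [← pow_succ', Nat.sub_add_cancel hp]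
      rw [h3, Module.End.mul_apply, hpow i (p - 1) (Nat.sub_lt hp one_pos), h2]
      simp
    · rw [hpow i.down s s.2]
      simp [Module.Basis.reindex_apply]

end NilpotentOperators

theorem jRank_baseChange {K : Type*} [Field K] {M : Type*} [AddCommGroup M] [Module K M]
    [FiniteDimensional K M] (L : Type*) [Field L] [Algebra K L] (j : ℕ) (f : Module.End K M) :
    jRank j (f.baseChange L) = jRank j f := by
  let b := Module.finBasis K M
  have h : ∀ d, d ≤ jRank j (f.baseChange L) ↔ d ≤ jRank j f := by
    intro d
    -- A family with a single member and coefficient `1`: the minors are evaluated at a `K`-point,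
    -- so they vanish over `L` exactly when they vanish over `K`.
    have h1 := le_jRank_iff_exists_powerMinor_baseChange L b (fun _ : Unit => f) j d (fun _ => 1)
    have h2 := le_jRank_iff_exists_powerMinor_self b (fun _ : Unit => f) j d (fun _ => 1)
    simp only [Finset.univ_unique, Finset.sum_const, Finset.card_singleton, one_smul] at h1 h2
    rw [h1, h2]
    have h3 : ∀ q : MvPolynomial Unit K, MvPolynomial.aeval (fun _ => (1 : L)) q =
        algebraMap K L (MvPolynomial.eval (fun _ => 1) q) := by
      intro q
      have := MvPolynomial.aeval_algebraMap_apply (A := K) (B := L) (fun _ : Unit => (1 : K)) q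
      rw [← MvPolynomial.aeval_eq_eval, ← this]
      simp [Function.comp_def]
    simp only [h3, ne_eq, map_eq_zero]
  exact le_antisymm ((h _).1 le_rfl) ((h _).2 le_rfl)

namespace IsDividedPowers

variable {K : Type*} [Field K] {V : Type*} [AddCommGroup V] [Module K V] {N : ℕ}
  {D : ℕ → Module.End K V} (hD : IsDividedPowers N D) (p : ℕ) [Fact p.Prime]

include hD

theorem sum_range_eq_sum_fin (c : ℕ → K) (r : ℕ) (hc : ∀ i, r ≤ i → i < N → p ^ i < N → c i = 0) :
    ∑ i ∈ Finset.range N, c i • D (p ^ i) = ∑ i : Fin r, c i • D (p ^ (i : ℕ)) := by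
  rw [← Finset.sum_range fun i => c i • D (p ^ i)]
  have hz : ∀ i, N ≤ i → D (p ^ i) = 0 := fun i hi =>
    hD.eq_zero _ (hi.trans (Nat.lt_pow_self (Fact.out : p.Prime).one_lt).le)
  rcases le_total r N with h | h
  · refine (Finset.sum_subset (Finset.range_subset_range.2 h) fun i hi hi' => ?_).symm
    rcases lt_or_ge (p ^ i) N with h1 | h1
    · rw [hc i (by simpa using hi') (Finset.mem_range.1 hi) h1, zero_smul]
    · rw [hD.eq_zero _ h1, smul_zero]
  · refine Finset.sum_subset (Finset.range_subset_range.2 h) fun i _ hi' => ?_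
    rw [hz i (by simpa using hi'), smul_zero]

end IsDividedPowers

/-! ### Actions at one-parameter subgroups and the maximal `j`-rank -/

namespace RationalGaModule

variable {k : Type u} [Field k] (p : ℕ) [Fact p.Prime]
  {M : Type v} [AddCommGroup M] [Module k M] (ρ : RationalGaModule k M)

theorem actionAt_eq_sum_fin {N : ℕ} (h : ρ.HasDegreeLT N) (r : ℕ) (σ : GaOneParam k)
    (hσ : ∀ i, r ≤ i → p ^ i < N → σ.coords p i = 0) :
    ρ.actionAt p σ = ∑ i : Fin r, (σ.coords p i) ^ p ^ (i : ℕ) • ρ.coeffOp (p ^ (i : ℕ)) := by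
  rw [ρ.actionAt_eq_sum p h, (ρ.isDividedPowers h).sum_range_eq_sum_fin p _ r]
  intro i hi _ hi'
  rw [hσ i hi hi', zero_pow (pow_pos (Fact.out : p.Prime).pos i).ne']

theorem actionAt_eq_zero_of_coords_eq_zero [FiniteDimensional k M] (σ : GaOneParam k)
    (hσ : σ.coords p = 0) : ρ.actionAt p σ = 0 := by
  obtain ⟨N, h⟩ := ρ.exists_hasDegreeLT
  rw [ρ.actionAt_eq_sum_fin p h 0 σ (fun i _ _ => by rw [hσ]; rfl)]
  simp

theorem actionAt_pow_prime [CharP k p] [FiniteDimensional k M] (σ : GaOneParam k) :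
    ρ.actionAt p σ ^ p = 0 := by
  obtain ⟨N, h⟩ := ρ.exists_hasDegreeLT
  rw [ρ.actionAt_eq_sum p h]
  exact (ρ.isDividedPowers h).sum_pow_prime_eq_zero p _ _

/-- There is a 1-parameter subgroup at which the `j`-rank is maximal. -/
theorem exists_forall_jRank_le [FiniteDimensional k M] (j : ℕ) :
    ∃ τ : GaOneParam k, ∀ σ, jRank j (ρ.actionAt p σ) ≤ jRank j (ρ.actionAt p τ) := by
  let S := Set.range fun σ : GaOneParam k => jRank j (ρ.actionAt p σ)
  have hne : S.Nonempty := ⟨_, GaOneParam.scaling 0, rfl⟩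
  have hb : BddAbove S := ⟨Module.finrank k M, by
    rintro _ ⟨σ, rfl⟩
    exact Submodule.finrank_le _⟩
  obtain ⟨τ, hτ⟩ := Nat.sSup_mem hne hb
  exact ⟨τ, fun σ => (le_csSup hb ⟨σ, rfl⟩).trans hτ.symm.le⟩

variable [CharP k p] [IsAlgClosed k]

/-- Every linear combination of the operators `u_0, …, u_{r-1}` is the action at a 1-parameter
subgroup. -/
theorem exists_actionAt_eq [FiniteDimensional k M] (r : ℕ) (x : Fin r → k) :
    ∃ σ : GaOneParam k, (∀ i : Fin r, (σ.coords p i) ^ p ^ (i : ℕ) = x i) ∧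
      (∀ i, r ≤ i → σ.coords p i = 0) ∧
      ρ.actionAt p σ = ∑ i : Fin r, x i • ρ.coeffOp (p ^ (i : ℕ)) := by
  have hp := (Fact.out : p.Prime)
  -- The `i`-th coordinate enters the action through its `p ^ i`-th power, so roots of the
  -- prescribed coefficients are needed.
  choose a ha using fun i : Fin r => IsAlgClosed.exists_pow_nat_eq (x i)
    (pow_pos hp.pos (i : ℕ))
  let f : ℕ →₀ k := Finsupp.onFinset (Finset.range r)
    (fun i => if h : i < r then a ⟨i, h⟩ else 0) fun i hi => by
      by_contra h
      exact hi (dif_neg (by simpa using h))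
  have h1 : ∀ i : Fin r, ((GaOneParam.ofCoords p f).coords p i) ^ p ^ (i : ℕ) = x i := by
    intro i
    rw [GaOneParam.coords_ofCoords, ← ha i]
    simp [f]
  have h2 : ∀ i, r ≤ i → (GaOneParam.ofCoords p f).coords p i = 0 := by
    intro i hi
    rw [GaOneParam.coords_ofCoords]
    simp [f, hi]
  obtain ⟨N, h⟩ := ρ.exists_hasDegreeLT
  refine ⟨GaOneParam.ofCoords p f, h1, h2, ?_⟩
  rw [ρ.actionAt_eq_sum_fin p h r _ fun i hi _ => h2 i hi]
  simp only [h1]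

theorem jRank_sum_le [FiniteDimensional k M] (j R : ℕ)
    (hR : ∀ σ, jRank j (ρ.actionAt p σ) ≤ R) (r : ℕ) (x : Fin r → k) :
    jRank j (∑ i : Fin r, x i • ρ.coeffOp (p ^ (i : ℕ))) ≤ R := by
  obtain ⟨σ, -, -, hσ⟩ := ρ.exists_actionAt_eq p r x
  rw [← hσ]
  exact hR σ

/-- The `j`-rank of the action of a Frobenius kernel and that of the corresponding 1-parameter
subgroup of the additive group, compared with the maximal `j`-rank of the latter. -/
theorem jRank_frobActionAt [FiniteDimensional k M] (j R : ℕ)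
    (hR : ∀ σ, jRank j (ρ.actionAt p σ) ≤ R) {r : ℕ} (hr : 0 < r) (h : ρ.HasDegreeLT (p ^ r))
    (σ : GaOneParam k) :
    jRank j (ρ.frobActionAt (σ.pr p r).reverse) ≤ R ∧
      (jRank j (ρ.frobActionAt (σ.pr p r).reverse) = R ↔ jRank j (ρ.actionAt p σ) = R) := by
  have hp := (Fact.out : p.Prime)
  have hD := ρ.isDividedPowers h
  have : Infinite k := IsAlgClosed.instInfinite
  have h1 := hD.jRank_le_and_eq_iff p (fun n => (σ.pr p r).reverse.element (Polynomial.X ^ n))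
    ((σ.pr p r).reverse.element_one hr) j R fun c => by
      rw [Finset.sum_range]
      exact ρ.jRank_sum_le p j R hR _ fun i => c i
  rw [frobActionAt, ρ.act_eq_sum h]
  -- The linear part of the Frobenius kernel action at the reversed tuple is the action at `σ`: the
  -- reversal in `element_X_pow` cancels the one in `reverse`.
  have h2 : ρ.actionAt p σ = ∑ i ∈ Finset.range (p ^ r),
      (σ.pr p r).reverse.element (Polynomial.X ^ p ^ i) • ρ.coeffOp (p ^ i) := by
    have hlt : ∀ i, r ≤ i → ¬ p ^ i < p ^ r := fun i hi =>
      not_lt.2 (Nat.pow_le_pow_right hp.pos hi)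
    rw [hD.sum_range_eq_sum_fin p (fun i => (σ.pr p r).reverse.element (Polynomial.X ^ p ^ i)) r
      fun i hi _ hi' => absurd hi' (hlt i hi),
      ρ.actionAt_eq_sum_fin p h r σ fun i hi hi' => absurd hi' (hlt i hi)]
    refine Finset.sum_congr rfl fun i _ => ?_
    rw [GaInfOneParam.element_X_pow _ _ i.2, GaInfOneParam.coords_reverse, Fin.rev_rev,
      GaOneParam.coords_pr]
  rw [h2]
  exact h1

end RationalGaModule

/-! ### Closed sets of one-parameter subgroups -/

section Topology

variable {k : Type u} [Field k]

theorem isClosed_zeroLocus_affineZariski (n : ℕ) (f : MvPolynomial (Fin n) k) :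
    IsClosed[affineZariski n k] {a | MvPolynomial.eval a f = 0} :=
  @IsClosed.mk _ (affineZariski n k) _ (TopologicalSpace.isOpen_generateFrom_of_mem ⟨f, rfl⟩)

theorem isClosed_affineZariski_singleton_zero (n : ℕ) :
    IsClosed[affineZariski n k] ({0} : Set (Fin n → k)) := by
  have h : ({0} : Set (Fin n → k)) = ⋂ i, {a | MvPolynomial.eval a (MvPolynomial.X i) = 0} := by
    ext a
    simp [funext_iff]
  rw [h]
  exact @isClosed_iInter _ _ (affineZariski n k) _ fun i => isClosed_zeroLocus_affineZariski n _

variable (p : ℕ) [Fact p.Prime] [CharP k p]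

theorem isClosed_gaTopology_preimage (r : ℕ) (hr : 0 < r) (Z : Set (Fin r → k))
    (hZ : IsClosed[affineZariski r k] Z) :
    IsClosed[gaTopology p k] {σ : GaOneParam k | (σ.pr p r).coords ∈ Z} := by
  have h1 : IsClosed[(infZariski p r k).induced (GaOneParam.pr p r)]
      {σ : GaOneParam k | (σ.pr p r).coords ∈ Z} := by
    refine (@isClosed_induced_iff _ _ (infZariski p r k) _ _).2
      ⟨GaInfOneParam.coords ⁻¹' Z, ?_, rfl⟩
    exact (@isClosed_induced_iff _ _ (affineZariski r k) _ _).2 ⟨Z, hZ, rfl⟩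
  exact h1.mono (iInf₂_le r hr)

/-- No single restriction detects the trivial subgroup, so all heights are intersected; heights are
shifted by one since the topology uses only positive ones. -/
theorem isClosed_coords_eq_zero :
    IsClosed[gaTopology p k] {σ : GaOneParam k | σ.coords p = 0} := by
  have h : {σ : GaOneParam k | σ.coords p = 0} =
      ⋂ r : ℕ, {σ | (σ.pr p (r + 1)).coords ∈ ({0} : Set (Fin (r + 1) → k))} := by
    ext σ
    simp only [Set.mem_ofPred_eq, Set.mem_singleton_iff, Set.mem_iInter, funext_iff,
      GaOneParam.coords_pr, Pi.zero_apply]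
    constructor
    · intro h r i
      rw [h]
      rfl
    · intro h
      ext s
      exact h s ⟨s, Nat.lt_succ_self s⟩
  rw [h]
  exact @isClosed_iInter _ _ (gaTopology p k) _ fun r =>
    isClosed_gaTopology_preimage p (r + 1) (Nat.succ_pos r) _
      (isClosed_affineZariski_singleton_zero (r + 1))

theorem isClosed_jRank_lt {M : Type v} [AddCommGroup M] [Module k M] [FiniteDimensional k M]
    (r : ℕ) (U : Fin r → Module.End k M) (e : Fin r → ℕ) (j R : ℕ) :
    IsClosed[affineZariski r k] {x : Fin r → k | jRank j (∑ i, x i ^ e i • U i) < R} := by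
  let b := Module.finBasis k M
  have h : {x : Fin r → k | jRank j (∑ i, x i ^ e i • U i) < R} =
      ⋂ (y : (Fin R → Fin (Module.finrank k M)) × (Fin R → Fin (Module.finrank k M))),
        {x | MvPolynomial.eval x (MvPolynomial.bind₁ (fun i => MvPolynomial.X i ^ e i)
          (powerMinor (fun i => LinearMap.toMatrix b b (U i)) j y.1 y.2)) = 0} := by
    ext x
    rw [Set.mem_ofPred_eq, ← not_le,
      le_jRank_iff_exists_powerMinor_self b U j R fun i => x i ^ e i]
    simp only [Set.mem_iInter, Set.mem_ofPred_eq, Prod.forall, not_exists, not_not,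
      ← MvPolynomial.aeval_eq_eval, MvPolynomial.aeval_bind₁, map_pow, MvPolynomial.aeval_X]
  rw [h]
  exact @isClosed_iInter _ _ (affineZariski r k) _ fun y => isClosed_zeroLocus_affineZariski r _

end Topology

namespace GaInfOneParam

variable {p r : ℕ} [Fact p.Prime] {K : Type u} [Field K] [CharP K p]

theorem coords_reverse_eq_zero_iff (μ : GaInfOneParam p r K) :
    μ.reverse.coords = 0 ↔ μ.coords = 0 := by
  simp only [funext_iff, coords_reverse, Pi.zero_apply]
  exact ⟨fun h s => by simpa using h s.rev, fun h s => h s.rev⟩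

theorem mem_image_reverse_iff (S : Set (GaInfOneParam p r K)) (μ : GaInfOneParam p r K) :
    μ ∈ reverse '' S ↔ μ.reverse ∈ S := by
  constructor
  · rintro ⟨ν, hν, rfl⟩
    rwa [reverse_reverse]
  · exact fun h => ⟨_, h, reverse_reverse μ⟩

end GaInfOneParam

namespace GaOneParam

variable (p r : ℕ) [Fact p.Prime] {K : Type u} [Field K] [CharP K p]

theorem pr_surjective : Function.Surjective (pr p r : GaOneParam K → GaInfOneParam p r K) := by
  intro μ
  let f : ℕ →₀ K := Finsupp.onFinset (Finset.range r)
    (fun i => if h : i < r then μ.coords ⟨i, h⟩ else 0) fun i hi => by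
      by_contra h
      exact hi (dif_neg (by simpa using h))
  refine ⟨ofCoords p f, ?_⟩
  rw [← GaInfOneParam.ofCoords_coords (pr p r (ofCoords p f)), ← GaInfOneParam.ofCoords_coords μ]
  congr 1
  ext i
  rw [coords_pr, coords_ofCoords]
  simp [f]

theorem coords_pr_eq_zero (σ : GaOneParam K) (h : σ.coords p = 0) : (σ.pr p r).coords = 0 := by
  ext i
  rw [coords_pr, h]
  rfl

end GaOneParam

/-! ### The non-maximal rank varieties and the assertions of the theorem -/

namespace RationalGaModule

variable {k : Type u} [Field k] (p : ℕ) [Fact p.Prime] [CharP k p]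
  {M : Type v} [AddCommGroup M] [Module k M] (ρ : RationalGaModule k M)

omit [CharP k p] in
theorem mem_nonMaxVariety_iff {j : ℕ} (τ : GaOneParam k)
    (hτ : ∀ σ, jRank j (ρ.actionAt p σ) ≤ jRank j (ρ.actionAt p τ)) (σ : GaOneParam k) :
    σ ∈ ρ.nonMaxVariety p j ↔
      σ.coords p = 0 ∨ jRank j (ρ.actionAt p σ) < jRank j (ρ.actionAt p τ) :=
  or_congr_right ⟨fun ⟨τ', h⟩ => h.trans_le (hτ τ'), fun h => ⟨τ, h⟩⟩

theorem actionAt_eq_zero_of_coords_pr_eq_zero {r : ℕ} (h : ρ.HasDegreeLT (p ^ r))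
    (σ : GaOneParam k) (hσ : (σ.pr p r).coords = 0) : ρ.actionAt p σ = 0 := by
  rw [ρ.actionAt_eq_sum_fin p h r σ fun i hi hi' => absurd hi'
    (not_lt.2 (Nat.pow_le_pow_right (Fact.out : p.Prime).pos hi))]
  refine Finset.sum_eq_zero fun i _ => ?_
  rw [← GaOneParam.coords_pr, hσ, Pi.zero_apply,
    zero_pow (pow_pos (Fact.out : p.Prime).pos _).ne', zero_smul]

variable [FiniteDimensional k M] [IsAlgClosed k]

/-- The maximum over the Frobenius kernel equals that over the additive group: it is bounded by it
because restriction is surjective, and it is attained at the reversed restriction of `τ`. -/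
theorem mem_preimage_reverse_frobNonMaxVariety_iff {j r : ℕ} (hr : 0 < r)
    (h : ρ.HasDegreeLT (p ^ r)) (τ : GaOneParam k)
    (hτ : ∀ σ, jRank j (ρ.actionAt p σ) ≤ jRank j (ρ.actionAt p τ)) (σ : GaOneParam k) :
    σ ∈ GaOneParam.pr p r ⁻¹' (GaInfOneParam.reverse '' ρ.frobNonMaxVariety p r j) ↔
      (σ.pr p r).coords = 0 ∨ jRank j (ρ.actionAt p σ) < jRank j (ρ.actionAt p τ) := by
  rw [Set.mem_preimage, GaInfOneParam.mem_image_reverse_iff]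
  refine or_congr (GaInfOneParam.coords_reverse_eq_zero_iff _) ?_
  obtain ⟨h1, h2⟩ := ρ.jRank_frobActionAt p j _ hτ hr h σ
  constructor
  · rintro ⟨ν, hν⟩
    obtain ⟨σ', hσ'⟩ := GaOneParam.pr_surjective p r ν.reverse
    have h3 := (ρ.jRank_frobActionAt p j _ hτ hr h σ').1
    rw [hσ', GaInfOneParam.reverse_reverse] at h3
    exact lt_of_le_of_ne (hτ σ) fun h4 => (hν.trans_le h3).ne (h2.2 h4)
  · intro h3
    refine ⟨(τ.pr p r).reverse, ?_⟩
    rw [(ρ.jRank_frobActionAt p j _ hτ hr h τ).2.2 rfl]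
    exact lt_of_le_of_ne h1 fun h4 => h3.ne (h2.1 h4)

theorem nonMaxVariety_union_eq {r : ℕ} (j : ℕ) (hr : 0 < r) (h : ρ.HasDegreeLT (p ^ r)) :
    ρ.nonMaxVariety p j ∪ {σ | (σ.pr p r).coords = 0} =
      GaOneParam.pr p r ⁻¹' (GaInfOneParam.reverse '' ρ.frobNonMaxVariety p r j) := by
  obtain ⟨τ, hτ⟩ := ρ.exists_forall_jRank_le p j
  ext σ
  rw [ρ.mem_preimage_reverse_frobNonMaxVariety_iff p hr h τ hτ, Set.mem_union,
    ρ.mem_nonMaxVariety_iff p τ hτ, Set.mem_ofPred_eq]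
  constructor
  · rintro ((h1 | h1) | h1)
    · exact Or.inl (GaOneParam.coords_pr_eq_zero p r σ h1)
    · exact Or.inr h1
    · exact Or.inl h1
  · rintro (h1 | h1)
    · exact Or.inr h1
    · exact Or.inl (Or.inr h1)

/-- By the union formula, equality means that the fibre of the restriction over zero lies in the
variety. The action vanishes on that fibre, so its points are non-maximal exactly when the maximal
`j`-rank is positive. -/
theorem nonMaxVariety_eq_iff {r j : ℕ} (hj : 1 ≤ j) (hr : 0 < r) (h : ρ.HasDegreeLT (p ^ r)) :
    ρ.nonMaxVariety p j =
        GaOneParam.pr p r ⁻¹' (GaInfOneParam.reverse '' ρ.frobNonMaxVariety p r j) ↔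
      ∃ σ : GaOneParam k, ρ.actionAt p σ ^ j ≠ 0 := by
  obtain ⟨τ, hτ⟩ := ρ.exists_forall_jRank_le p j
  rw [← ρ.nonMaxVariety_union_eq p j hr h, eq_comm, Set.union_eq_left]
  constructor
  · intro hsub
    by_contra! h0
    have hrank : ∀ σ, jRank j (ρ.actionAt p σ) = 0 := fun σ => (jRank_eq_zero_iff j _).2 (h0 σ)
    -- The subgroup `T ↦ T ^ p ^ r` is nontrivial but restricts to zero on the `r`-th Frobenius
    -- kernel.
    let σ := GaOneParam.ofCoords p (Finsupp.single r (1 : k))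
    have hσ : (σ.pr p r).coords = 0 := by
      ext i
      rw [GaOneParam.coords_pr, GaOneParam.coords_ofCoords, Finsupp.single_apply,
        if_neg i.2.ne', Pi.zero_apply]
    rcases (ρ.mem_nonMaxVariety_iff p τ hτ σ).1 (hsub hσ) with h1 | h1
    · rw [GaOneParam.coords_ofCoords, Finsupp.single_eq_zero] at h1
      exact one_ne_zero h1
    · rw [hrank, hrank] at h1
      exact lt_irrefl _ h1
  · rintro ⟨σ', hσ'⟩ σ hσ
    refine (ρ.mem_nonMaxVariety_iff p τ hτ σ).2 (Or.inr ?_)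
    rw [ρ.actionAt_eq_zero_of_coords_pr_eq_zero p h σ hσ, jRank_zero_right hj]
    exact (Nat.pos_of_ne_zero fun h0 => hσ' ((jRank_eq_zero_iff j _).1 h0)).trans_le (hτ σ')

-- If the maximal `j`-rank is zero, only the trivial subgroup remains. Otherwise the trivial
-- subgroup is itself of non-maximal rank, and the variety is pulled back from a determinantal locus
-- at finite height.
omit [IsAlgClosed k] in
theorem isClosed_nonMaxVariety {j : ℕ} (hj : 1 ≤ j) :
    IsClosed[gaTopology p k] (ρ.nonMaxVariety p j) := by
  obtain ⟨τ, hτ⟩ := ρ.exists_forall_jRank_le p j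
  rcases Nat.eq_zero_or_pos (jRank j (ρ.actionAt p τ)) with h0 | h0
  · have h : ρ.nonMaxVariety p j = {σ | σ.coords p = 0} := by
      ext σ
      rw [ρ.mem_nonMaxVariety_iff p τ hτ, h0]
      simp
    rw [h]
    exact isClosed_coords_eq_zero p
  · obtain ⟨N, hN⟩ := ρ.exists_hasDegreeLT
    -- The height `N + 1` is used because it is positive even if `N = 0`.
    have hN' := ρ.hasDegreeLT_mono (Nat.le_succ N) hN
    have h : ρ.nonMaxVariety p j = {σ | (σ.pr p (N + 1)).coords ∈
        {x : Fin (N + 1) → k | jRank j (∑ i, x i ^ p ^ (i : ℕ) • ρ.coeffOp (p ^ (i : ℕ))) <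
          jRank j (ρ.actionAt p τ)}} := by
      ext σ
      have hσ : jRank j (ρ.actionAt p σ) = jRank j (∑ i : Fin (N + 1),
          (σ.pr p (N + 1)).coords i ^ p ^ (i : ℕ) • ρ.coeffOp (p ^ (i : ℕ))) := by
        rw [ρ.actionAt_eq_sum_fin p hN' (N + 1) σ fun i hi hi' =>
          absurd ((Nat.lt_pow_self (Fact.out : p.Prime).one_lt).trans hi') (not_lt.2 hi)]
        simp only [GaOneParam.coords_pr]
      rw [ρ.mem_nonMaxVariety_iff p τ hτ, Set.mem_ofPred_eq, Set.mem_ofPred_eq, ← hσ]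
      refine or_iff_right_of_imp fun h1 => ?_
      rwa [ρ.actionAt_eq_zero_of_coords_eq_zero p σ h1, jRank_zero_right hj]
    rw [h]
    exact isClosed_gaTopology_preimage p (N + 1) (Nat.succ_pos N) _
      (isClosed_jRank_lt _ _ _ _ _)

omit [IsAlgClosed k] in
theorem nonMaxVariety_ne_univ {j : ℕ} (hj : 1 ≤ j) : ρ.nonMaxVariety p j ≠ Set.univ := by
  obtain ⟨τ, hτ⟩ := ρ.exists_forall_jRank_le p j
  rw [Set.ne_univ_iff_exists_notMem]
  by_cases h : τ.coords p = 0
  · refine ⟨GaOneParam.ofCoords p (Finsupp.single 0 1), ?_⟩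
    rw [ρ.mem_nonMaxVariety_iff p τ hτ, ρ.actionAt_eq_zero_of_coords_eq_zero p τ h,
      jRank_zero_right hj, GaOneParam.coords_ofCoords]
    simp
  · refine ⟨τ, ?_⟩
    rw [ρ.mem_nonMaxVariety_iff p τ hτ]
    simp [h]

-- A free action attains the bound `(p - j) dim M / p`, which is positive, so the point is
-- nontrivial and no other point has larger `j`-rank.
omit [IsAlgClosed k] in
theorem nonMaxVariety_subset_supportVariety [Nontrivial M] {j : ℕ} (hj : 1 ≤ j) (hjp : j < p) :
    ρ.nonMaxVariety p j ⊆ ρ.supportVariety p := by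
  have hpos : 0 < (p - j) * Module.finrank k M :=
    Nat.mul_pos (Nat.sub_pos_of_lt hjp) Module.finrank_pos
  intro σ hσ hfree
  rw [actsFreely_iff _ (ρ.actionAt_pow_prime p σ) j hj hjp] at hfree
  rcases hσ with h | ⟨τ, hτ⟩
  · rw [ρ.actionAt_eq_zero_of_coords_eq_zero p σ h, jRank_zero_right hj, mul_zero] at hfree
    exact hpos.ne hfree
  · have h1 := mul_jRank_le _ (ρ.actionAt_pow_prime p τ) j hjp.le
    rw [← hfree] at h1
    exact absurd (le_of_mul_le_mul_left h1 (Fact.out : p.Prime).pos) (not_le.2 hτ)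

-- Properness of the variety produces a point with free action when the two sets agree. Conversely,
-- one free action makes the universal bound the maximal `j`-rank, so every point off the variety
-- attains it and is free.
omit [IsAlgClosed k] in
theorem nonMaxVariety_eq_supportVariety_iff [Nontrivial M] {j : ℕ} (hj : 1 ≤ j) (hjp : j < p) :
    ρ.nonMaxVariety p j = ρ.supportVariety p ↔
      ∃ σ : GaOneParam k, ActsFreely p (ρ.actionAt p σ) := by
  constructor
  · intro h
    obtain ⟨σ, hσ⟩ := (Set.ne_univ_iff_exists_notMem _).1 (h ▸ ρ.nonMaxVariety_ne_univ p hj)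
    exact ⟨σ, not_not.1 hσ⟩
  · rintro ⟨σ, hσ⟩
    refine (ρ.nonMaxVariety_subset_supportVariety p hj hjp).antisymm fun τ hτ => ?_
    by_contra hτ'
    have h1 : jRank j (ρ.actionAt p σ) ≤ jRank j (ρ.actionAt p τ) :=
      not_lt.1 fun h => hτ' (Or.inr ⟨σ, h⟩)
    rw [actsFreely_iff _ (ρ.actionAt_pow_prime p σ) j hj hjp] at hσ
    refine hτ ((actsFreely_iff _ (ρ.actionAt_pow_prime p τ) j hj hjp).2 (le_antisymm
      (mul_jRank_le _ (ρ.actionAt_pow_prime p τ) j hjp.le) ?_))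
    rw [← hσ]
    exact Nat.mul_le_mul_left p h1

theorem hasConstantJRank_of_inter_eq_empty {r : ℕ} (j : ℕ) (hr : 0 < r)
    (hV : ρ.nonMaxVariety p j ∩ {σ | σ.coords p ≠ 0 ∧ ∀ s ≥ r, σ.coords p s = 0} = ∅) :
    ρ.HasConstantJRank p r j := by
  have hp := (Fact.out : p.Prime)
  have : Infinite k := IsAlgClosed.instInfinite
  obtain ⟨τ, hτ⟩ := ρ.exists_forall_jRank_le p j
  obtain ⟨N, hN⟩ := ρ.exists_hasDegreeLT
  refine ⟨jRank j (ρ.actionAt p τ), fun L _ _ _ μ hμ => ?_⟩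
  have : Infinite L := Infinite.of_injective _ (algebraMap k L).injective
  have hD := ρ.isDividedPowers_baseChange hN L
  rw [ρ.actBaseChange_eq_sum hN]
  -- The maximal `j`-rank over `k` still bounds the linear combinations over `L`, so it suffices to
  -- show that the linear part of the action at `μ` attains it.
  have h1 := hD.jRank_le_and_eq_iff p (fun n => μ.element (Polynomial.X ^ n)) (μ.element_one hr) j
    (jRank j (ρ.actionAt p τ)) fun c => by
      rw [Finset.sum_range]
      exact jRank_baseChange_le L (fun i : Fin N => ρ.coeffOp (p ^ (i : ℕ))) j _
        (ρ.jRank_sum_le p j _ hτ N) fun i => c i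
  refine h1.2.2 (le_antisymm ?_ ?_) <;>
  rw [hD.sum_range_eq_sum_fin p (fun i => μ.element (Polynomial.X ^ p ^ i)) r
    fun i hi _ _ => μ.element_X_pow_of_le hr i hi]
  · exact jRank_baseChange_le L (fun i : Fin r => ρ.coeffOp (p ^ (i : ℕ))) j _
      (ρ.jRank_sum_le p j _ hτ r) fun i => μ.element (Polynomial.X ^ p ^ (i : ℕ))
  · refine le_jRank_baseChange L (fun i : Fin r => ρ.coeffOp (p ^ (i : ℕ))) j _ ?_
      (fun i => μ.element (Polynomial.X ^ p ^ (i : ℕ))) ?_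
    -- Over `k`, a nonzero combination of the first `r` operators is the action at a nontrivial
    -- subgroup with `a_s = 0` for `s ≥ r`, which the hypothesis makes maximal.
    · intro x hx
      obtain ⟨σ, h2, h3, h4⟩ := ρ.exists_actionAt_eq p r x
      rw [← h4]
      by_contra! hlt
      refine (Set.eq_empty_iff_forall_notMem.1 hV σ) ⟨Or.inr ⟨τ, hlt⟩, fun h0 => hx ?_, h3⟩
      ext i
      rw [← h2 i, h0, Finsupp.coe_zero, Pi.zero_apply, zero_pow (pow_pos hp.pos _).ne',
        Pi.zero_apply]
    · intro h0
      refine hμ (funext fun s => ?_)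
      have h2 := congrFun h0 s.rev
      rw [GaInfOneParam.element_X_pow _ _ s.rev.2] at h2
      have h3 : μ.coords s.rev.rev = 0 := IsNilpotent.eq_zero ⟨_, h2⟩
      rwa [Fin.rev_rev] at h3

theorem inter_eq_empty_of_hasConstantJRank {r j : ℕ} (hj : 1 ≤ j) (hr : 0 < r)
    (h : ρ.HasDegreeLT (p ^ r)) (hconst : ρ.HasConstantJRank p r j) :
    ρ.nonMaxVariety p j ∩ {σ | σ.coords p ≠ 0 ∧ ∀ s ≥ r, σ.coords p s = 0} = ∅ := by
  obtain ⟨τ, hτ⟩ := ρ.exists_forall_jRank_le p j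
  obtain ⟨c, hc⟩ := hconst
  have hfrob : ∀ σ : GaOneParam k, (σ.pr p r).coords ≠ 0 →
      jRank j (ρ.frobActionAt (σ.pr p r).reverse) = c := by
    intro σ hσ
    -- Only the trivial extension `L = k` is needed for the converse.
    rw [← hc k (σ.pr p r).reverse (mt (GaInfOneParam.coords_reverse_eq_zero_iff _).1 hσ),
      ρ.actBaseChange_eq_sum h, frobActionAt, ρ.act_eq_sum h, ← jRank_baseChange k]
    congr 1
    ext m
    simp [LinearMap.sum_apply, TensorProduct.tmul_sum]
  refine Set.eq_empty_iff_forall_notMem.2 fun σ ⟨hσ, hσ0, hσr⟩ => ?_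
  have hlt := ((ρ.mem_nonMaxVariety_iff p τ hτ σ).1 hσ).resolve_left hσ0
  -- Otherwise the maximal `j`-rank would be zero and no `σ` could lie strictly below it. Hence the
  -- constant equals the maximum, contradicting non-maximality at `σ`.
  have hτ0 : (τ.pr p r).coords ≠ 0 := fun h0 => by
    rw [ρ.actionAt_eq_zero_of_coords_pr_eq_zero p h τ h0, jRank_zero_right hj] at hlt
    exact Nat.not_lt_zero _ hlt
  have hσ0' : (σ.pr p r).coords ≠ 0 := fun h0 => hσ0 <| by
    ext s
    rcases lt_or_ge s r with hs | hs
    · have := congrFun h0 ⟨s, hs⟩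
      rwa [GaOneParam.coords_pr] at this
    · exact hσr s hs
  have h1 := (ρ.jRank_frobActionAt p j _ hτ hr h τ).2.2 rfl
  rw [hfrob τ hτ0, ← hfrob σ hσ0'] at h1
  exact hlt.ne ((ρ.jRank_frobActionAt p j _ hτ hr h σ).2.1 h1)

end RationalGaModule

end

theorem mainTheorem6 {k : Type u} [Field k] [IsAlgClosed k] (p : ℕ) [Fact p.Prime] [CharP k p]
    {M : Type v} [AddCommGroup M] [Module k M] [FiniteDimensional k M]
    (ρ : RationalGaModule k M) (j : ℕ) (hj : 1 ≤ j) (hjp : j < p) :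
    (∀ r : ℕ, 0 < r → ρ.HasDegreeLT (p ^ r) →
      (ρ.nonMaxVariety p j ∪ {σ | (σ.pr p r).coords = 0} =
        GaOneParam.pr p r ⁻¹' (GaInfOneParam.reverse '' ρ.frobNonMaxVariety p r j)) ∧
      (ρ.nonMaxVariety p j =
          GaOneParam.pr p r ⁻¹' (GaInfOneParam.reverse '' ρ.frobNonMaxVariety p r j) ↔
        ∃ σ : GaOneParam k, ρ.actionAt p σ ^ j ≠ 0)) ∧
    (IsClosed[gaTopology p k] (ρ.nonMaxVariety p j) ∧ ρ.nonMaxVariety p j ≠ Set.univ) ∧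
    (Nontrivial M →
      ρ.nonMaxVariety p j ⊆ ρ.supportVariety p ∧
      (ρ.nonMaxVariety p j = ρ.supportVariety p ↔
        ∃ (σ : GaOneParam k) (n : ℕ) (ℓ : Fin n → ℕ),
          HasJordanBlocks (ρ.actionAt p σ) ℓ ∧ ∀ i, ℓ i = p)) ∧
    (∀ r : ℕ, 0 < r →
      (ρ.nonMaxVariety p j ∩ {σ | σ.coords p ≠ 0 ∧ ∀ s ≥ r, σ.coords p s = 0} = ∅ →
        ρ.HasConstantJRank p r j) ∧
      (ρ.HasDegreeLT (p ^ r) →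
        (ρ.HasConstantJRank p r j ↔
          ρ.nonMaxVariety p j ∩ {σ | σ.coords p ≠ 0 ∧ ∀ s ≥ r, σ.coords p s = 0} = ∅))) := by
  refine ⟨fun r hr h => ⟨ρ.nonMaxVariety_union_eq p j hr h, ρ.nonMaxVariety_eq_iff p hj hr h⟩,
    ⟨ρ.isClosed_nonMaxVariety p hj, ρ.nonMaxVariety_ne_univ p hj⟩, fun _ =>
      ⟨ρ.nonMaxVariety_subset_supportVariety p hj hjp, ?_⟩, fun r hr =>
      ⟨ρ.hasConstantJRank_of_inter_eq_empty p j hr, fun h =>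
        ⟨ρ.inter_eq_empty_of_hasConstantJRank p hj hr h,
          ρ.hasConstantJRank_of_inter_eq_empty p j hr⟩⟩⟩
  rw [ρ.nonMaxVariety_eq_supportVariety_iff p hj hjp]
  simp only [actsFreely_iff_exists_hasJordanBlocks (Fact.out : p.Prime).pos]
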